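/- Let $G$ be a locally compact (Hausdorff) group with left Haar measure and modular function $\Delta$ (normalized by $\lambda(Eq)=\Delta(q)\lambda(E)$), let $G^{\mathrm{op}}$ be $G$ with the opposite multiplication, and let $L^1(G)$ be the convolution algebra. Regard $L^1(G\times G)=L^1(G)\mathbin{\widehat{\otimes}}L^1(G)$ as an $L^1(G)$-bimodule via $b\cdot(u\otimes v)=(b*u)\otimes v$ and $(u\otimes v)\cdot a=u\otimes(v*a)$, that is, $(b\cdot w)(s,t)=\int b(r)\,w(r^{-1}s,t)\,dr$ and $(w\cdot a)(s,t)=\int w(s,tq^{-1})\,\Delta(q^{-1})\,a(q)\,dq$. Let $L^\infty(G\times G)=L^1(G\times G)^*$ (essentially bounded functions modulo equality locally almost everywhere) carry the dual bimodule structure, so that $a\cdot F\cdot b\in L^\infty(G\times G)$ is the unique element with $\langle a\cdot F\cdot b,w\rangle=\langle F,\,b\cdot w\cdot a\rangle$ for all $w\in L^1(G\times G)$. Let $$L^\infty(G\times G)_{\mathrm{ess}}=\operatorname{lin}\{a\cdot F\cdot b : a,b\in L^1(G),\ F\in L^\infty(G\times G)\}$$ be its essential part (linear span, without closure). For a locally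 compact group $H$, let $\mathrm{LUC}(H)$ be the space of all bounded continuous functions $f:H\to\mathbb{C}$ for which the map $x\mapsto f\cdot\delta_x$, where $(f\cdot\delta_x)(t)=f(xt)$, is continuous from $H$ to the bounded continuous functions on $H$ with the supremum norm. Then, identifying functions on $G\times G^{\mathrm{op}}$ with functions on $G\times G$ and bounded continuous functions with their classes in $L^\infty(G\times G)$, $$L^\infty(G\times G)_{\mathrm{ess}}=\mathrm{LUC}(G\times G^{\mathrm{op}}).$$ -/

import Mathlib

open MeasureTheory MeasureTheory.Measure MulOpposite
open scoped ENNReal BoundedContinuousFunction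

noncomputable section

/-- For a topological group `H`, the space `LUC(H)` of left uniformly continuous bounded functions:
those bounded continuous `f : H → ℂ` for which `x ↦ (t ↦ f (x * t))` is continuous from `H` to
the bounded continuous functions on `H` with the supremum norm. -/
def LUC (H : Type*) [TopologicalSpace H] [Group H] [IsTopologicalGroup H] :
    Submodule ℂ (H →ᵇ ℂ) where
  carrier := {f | Continuous fun x : H => f.compContinuous (ContinuousMap.mulLeft x)}
  zero_mem' := by
    have h : (fun x : H => (0 : H →ᵇ ℂ).compContinuous (ContinuousMap.mulLeft x)) =
        fun _ => 0 := by
      funext x; ext t; rfl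
    simp only [Set.mem_ofPred_eq, h]
    exact continuous_const
  add_mem' := fun {f g} hf hg => Continuous.add hf hg
  smul_mem' := fun c _ hf => Continuous.const_smul hf c

/-- The product group `G × G`, as a type of its own so that it can carry its Borel `σ`-algebra
(for a large group `G` the product of the Borel `σ`-algebras of the factors is smaller). -/
def SqGroup (G : Type*) : Type _ := G × G

namespace SqGroup

variable {G : Type*}

instance [Group G] : Group (SqGroup G) := inferInstanceAs (Group (G × G))

instance [TopologicalSpace G] : TopologicalSpace (SqGroup G) :=
  inferInstanceAs (TopologicalSpace (G × G))

instance [TopologicalSpace G] [Group G] [IsTopologicalGroup G] : IsTopologicalGroup (SqGroup G) :=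
  inferInstanceAs (IsTopologicalGroup (G × G))

instance [TopologicalSpace G] [LocallyCompactSpace G] : LocallyCompactSpace (SqGroup G) :=
  inferInstanceAs (LocallyCompactSpace (G × G))

instance [TopologicalSpace G] [T2Space G] : T2Space (SqGroup G) :=
  inferInstanceAs (T2Space (G × G))

instance [TopologicalSpace G] : MeasurableSpace (SqGroup G) := borel _

instance [TopologicalSpace G] : BorelSpace (SqGroup G) := ⟨rfl⟩

/-- The element `(s, t)` of `G × G`. -/
def mk (s t : G) : SqGroup G := (s, t)

/-- The identification of sets, and of topological spaces, of `G × G` with `G × Gᵒᵖ`. -/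
def toProdOp (p : SqGroup G) : G × Gᵐᵒᵖ := (p.1, op p.2)

theorem continuous_toProdOp [TopologicalSpace G] :
    Continuous (toProdOp : SqGroup G → G × Gᵐᵒᵖ) :=
  (continuous_fst (X := G) (Y := G)).prodMk
    (continuous_op.comp (continuous_snd (X := G) (Y := G)))

end SqGroup

theorem memLp_top_comp_toProdOp {G : Type*} [TopologicalSpace G] (ν : Measure (SqGroup G)) (f : G × Gᵐᵒᵖ →ᵇ ℂ) :
    MemLp (fun p : SqGroup G => f p.toProdOp) ∞ ν :=
  memLp_top_of_bound
    (f.continuous.comp SqGroup.continuous_toProdOp).aestronglyMeasurable ‖f‖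
    (Filter.Eventually.of_forall fun p => f.norm_coe_le_norm p.toProdOp)

variable {G : Type*} [Group G] [TopologicalSpace G] [IsTopologicalGroup G] [LocallyCompactSpace G]

/-- Left translation on `L¹(G × G)` in the first variable, the action `w ↦ δ_r · w` of a point mass:
`(δ_r · w)(s, t) = w (r⁻¹ s, t)`. -/
def leftTranslate (ν : Measure (SqGroup G)) [ν.IsHaarMeasure] (r : G) (w : Lp ℂ 1 ν) : Lp ℂ 1 ν :=
  Lp.compMeasurePreserving (fun p => SqGroup.mk r⁻¹ 1 * p)
    (measurePreserving_mul_left ν (SqGroup.mk r⁻¹ 1)) w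

theorem memLp_rightTranslate (ν : Measure (SqGroup G)) [ν.IsHaarMeasure] [ν.InnerRegular] (q : G)
    (w : Lp ℂ 1 ν) :
    MemLp (fun p => ((modularCharacterFun q : ℝ) : ℂ) * w (p * SqGroup.mk 1 q⁻¹)) 1 ν := by
  refine MemLp.const_mul ?_ _
  have h : Measurable fun p : SqGroup G => p * SqGroup.mk 1 q⁻¹ := measurable_mul_const _
  have hw : MemLp w 1 (Measure.map (fun p => p * SqGroup.mk 1 q⁻¹) ν) := by
    rw [map_right_mul_eq_modularCharacterFun_smul]
    exact (Lp.memLp w).smul_measure ENNReal.coe_ne_top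
  exact hw.comp_of_map h.aemeasurable

/-- Right translation on `L¹(G × G)` in the second variable, the action `w ↦ w · δ_q` of a point
mass: `(w · δ_q)(s, t) = Δ(q⁻¹) w (s, t q⁻¹)`, where `Δ` is the modular function normalized by
`λ(E q) = Δ(q) λ(E)`; Mathlib's `modularCharacterFun q` is `Δ(q⁻¹)`. -/
def rightTranslate (ν : Measure (SqGroup G)) [ν.IsHaarMeasure] [ν.InnerRegular] (q : G)
    (w : Lp ℂ 1 ν) : Lp ℂ 1 ν :=
  (memLp_rightTranslate ν q w).toLp _

variable [MeasurableSpace G]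

/-- The left action of `L¹(G)` on `L¹(G × G) = L¹(G) ⊗̂ L¹(G)`, by convolution in the first variable:
`(b · w)(s, t) = ∫ b(r) w(r⁻¹ s, t) dr`, so that `b · (u ⊗ v) = (b * u) ⊗ v`.
The integral is a Bochner integral in `L¹(G × G)`. -/
def leftAct (μ : Measure G) (ν : Measure (SqGroup G)) [ν.IsHaarMeasure]
    (b : Lp ℂ 1 μ) (w : Lp ℂ 1 ν) : Lp ℂ 1 ν :=
  ∫ r, b r • leftTranslate ν r w ∂μ

/-- The right action of `L¹(G)` on `L¹(G × G) = L¹(G) ⊗̂ L¹(G)`, by convolution in the second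
variable: `(w · a)(s, t) = ∫ w(s, t q⁻¹) Δ(q⁻¹) a(q) dq`, so that `(u ⊗ v) · a = u ⊗ (v * a)`.
The integral is a Bochner integral in `L¹(G × G)`. -/
def rightAct (μ : Measure G) (ν : Measure (SqGroup G)) [ν.IsHaarMeasure] [ν.InnerRegular]
    (w : Lp ℂ 1 ν) (a : Lp ℂ 1 μ) : Lp ℂ 1 ν :=
  ∫ q, a q • rightTranslate ν q w ∂μ

/-- The duality pairing of `L^∞(G × G)` with `L¹(G × G)`. -/
def dualPairing (ν : Measure (SqGroup G)) (F : Lp ℂ ∞ ν) (w : Lp ℂ 1 ν) : ℂ :=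
  ∫ p, F p * w p ∂ν

/-- `Φ = a · F · b` in the dual `L¹(G)`-bimodule `L^∞(G × G) = L¹(G × G)^*`: that is,
`⟨Φ, w⟩ = ⟨F, b · w · a⟩` for all `w` in `L¹(G × G)`. -/
def IsDualAct (μ : Measure G) (ν : Measure (SqGroup G)) [ν.IsHaarMeasure] [ν.InnerRegular]
    (a : Lp ℂ 1 μ) (F : Lp ℂ ∞ ν) (b : Lp ℂ 1 μ) (Φ : Lp ℂ ∞ ν) : Prop :=
  ∀ w : Lp ℂ 1 ν, dualPairing ν Φ w = dualPairing ν F (rightAct μ ν (leftAct μ ν b w) a)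

/-- The essential part of the `L¹(G)`-bimodule `L^∞(G × G)`: the linear span (no closure is taken)
of all products `a · F · b` with `a, b` in `L¹(G)` and `F` in `L^∞(G × G)`. -/
def essentialPart (μ : Measure G) (ν : Measure (SqGroup G)) [ν.IsHaarMeasure] [ν.InnerRegular] :
    Submodule ℂ (Lp ℂ ∞ ν) :=
  Submodule.span ℂ {Φ | ∃ (a : Lp ℂ 1 μ) (F : Lp ℂ ∞ ν) (b : Lp ℂ 1 μ), IsDualAct μ ν a F b Φ}

/-- The natural map from the bounded continuous functions on `G × Gᵒᵖ` to `L^∞(G × G)`: a function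
is sent to its class. -/
def bcfToLInfty (ν : Measure (SqGroup G)) : (G × Gᵐᵒᵖ →ᵇ ℂ) →ₗ[ℂ] Lp ℂ ∞ ν where
  toFun f := (memLp_top_comp_toProdOp ν f).toLp _
  map_add' _ _ := rfl
  map_smul' _ _ := rfl

end

/-! Write `c` for the constant relating `ν` to the iterated Haar integral. For `a`, `b` in `C_c(G)`,
the product a·F·b is the function (s, t) ↦ ∫∫ b(r) a(q) F(rs, tq) dr dq, which is c⁻¹ times the
pairing of F with an L¹ kernel where s translates b on the right and t translates a on the left
(`isDualAct_smoothing`). Left translation in G × Gᵒᵖ sends (s, t) to (rs, tq), so it can be moved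
onto b and a, where it is L¹-continuous; hence the function lies in LUC. The bound ‖F‖‖b‖‖a‖ and the
closedness of LUC then give all `a`, `b` in L¹ (`exists_LUC_isDualAct`).

Conversely, L¹(G) acts on the Banach space LUC(G × Gᵒᵖ) in two ways, by averaging translations in
either coordinate. Both actions are strongly continuous, so Cohen's theorem (`exists_factorization`)
writes f as an average of some g in the first coordinate, and g as an average of some F in the
second. The averages are adjoint to the module actions on L¹(G × G), whence f = a·F·b
(`exists_isDualAct_of_mem_LUC`). In particular each element of the essential part is a single
product.

The Haar measures are inner regular and need not be σ-finite, and `ν` is not given as a product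
measure. Double integrals are therefore interchanged only for compactly supported continuous
functions, and the results pass to L¹ by density. -/

noncomputable section

open Filter Topology
open scoped CompactlySupported

set_option linter.unusedSectionVars false

/-! ### The pairing of L^∞ with L¹. -/

section Pairing

variable {Z : Type*} [MeasurableSpace Z]

/-- Bounded measurable functions act on `L¹` as continuous functionals. -/
theorem lpPairing_mul_apply {ρ : Measure Z} (F : Lp ℂ ∞ ρ) (w : Lp ℂ 1 ρ) :
    (ContinuousLinearMap.mul ℂ ℂ).lpPairing ρ ∞ 1 F w = ∫ z, F z * w z ∂ρ := by
  rw [ContinuousLinearMap.lpPairing_eq_integral]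
  rfl

theorem norm_lpPairing_mul_le {ρ : Measure Z} (F : Lp ℂ ∞ ρ) (w : Lp ℂ 1 ρ) :
    ‖(ContinuousLinearMap.mul ℂ ℂ).lpPairing ρ ∞ 1 F w‖ ≤ ‖F‖ * ‖w‖ := by
  have h : ∫ z, F z * w z ∂ρ = L1.integral ((ContinuousLinearMap.mul ℂ ℂ).holder 1 F w) := by
    rw [L1.integral_eq_integral]
    exact integral_congr_ae 
      (ContinuousLinearMap.coeFn_holder (ContinuousLinearMap.mul ℂ ℂ) F w).symm
  rw [lpPairing_mul_apply, h]
  refine (L1.norm_integral_le _).trans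
    ((ContinuousLinearMap.norm_holder_apply_apply_le _ _ _).trans ?_)
  gcongr
  calc _ ≤ 1 * ‖F‖ := by gcongr; exact ContinuousLinearMap.opNorm_mul_le ℂ ℂ
    _ = _ := one_mul _

/-- Makes integration over a set a continuous functional on L¹, so that it commutes with Bochner
integrals. -/
theorem setIntegral_eq_lpPairing {ρ : Measure Z} {S : Set Z} (hS : MeasurableSet S)
    (hS' : ρ S ≠ ∞) (w : Lp ℂ 1 ρ) :
    (ContinuousLinearMap.mul ℂ ℂ).lpPairing ρ ∞ 1 (indicatorConstLp ∞ hS hS' 1) w =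
      ∫ z in S, w z ∂ρ := by
  rw [lpPairing_mul_apply, ← integral_indicator hS]
  refine integral_congr_ae ?_
  filter_upwards [indicatorConstLp_coeFn (p := ∞) (hs := hS) (hμs := hS') (c := (1 : ℂ))] with z hz
  rw [hz]
  by_cases h : z ∈ S <;> simp [h]

end Pairing

/-! ### Compactly supported functions in L¹, density and vector-valued integrals. -/

section L1

variable {Z : Type*} [TopologicalSpace Z] [MeasurableSpace Z] [BorelSpace Z]

/-- The class in `L¹` of a compactly supported continuous function. -/
def toL1 (ρ : Measure Z) [IsFiniteMeasureOnCompacts ρ] (f : C_c(Z, ℂ)) : Lp ℂ 1 ρ :=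
  (f.continuous.memLp_of_hasCompactSupport f.hasCompactSupport (μ := ρ)).toLp f

variable (ρ : Measure Z) [IsFiniteMeasureOnCompacts ρ]

theorem coeFn_toL1 (f : C_c(Z, ℂ)) : toL1 ρ f =ᵐ[ρ] f := MemLp.coeFn_toLp _

theorem integrable_cc (f : C_c(Z, ℂ)) : Integrable f ρ :=
  f.continuous.integrable_of_hasCompactSupport f.hasCompactSupport

theorem toL1_sub (f g : C_c(Z, ℂ)) : toL1 ρ (f - g) = toL1 ρ f - toL1 ρ g := rfl

theorem toL1_smul (c : ℂ) (f : C_c(Z, ℂ)) : toL1 ρ (c • f) = c • toL1 ρ f := rfl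

theorem norm_toL1 (f : C_c(Z, ℂ)) : ‖toL1 ρ f‖ = ∫ z, ‖f z‖ ∂ρ := by
  rw [L1.norm_eq_integral_norm]
  exact integral_congr_ae ((coeFn_toL1 ρ f).fun_comp norm)

/-- Inner regularity yields a compact K inside s of nearly full measure. An open U around K, rather
than around s, has nearly the measure of K, and a Urysohn function between K and U does the rest. -/
theorem exists_cc_eLpNorm_sub_indicator_le [T2Space Z] [LocallyCompactSpace Z] [ρ.InnerRegular]
    (c : ℂ) {s : Set Z} (hs : MeasurableSet s) (hs' : ρ s < ∞) {ε : ℝ≥0∞} (hε : ε ≠ 0) :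
    ∃ g : Z → ℂ, eLpNorm (g - s.indicator fun _ => c) 1 ρ ≤ ε ∧
      (Continuous g ∧ HasCompactSupport g) := by
  obtain ⟨δ, δpos, hδ⟩ := exists_Lp_half ℂ ρ 1 hε
  obtain ⟨η, ηpos, hη⟩ :
      ∃ η : NNReal, 0 < η ∧ ∀ s : Set Z, ρ s ≤ η → eLpNorm (s.indicator fun _ => c) 1 ρ ≤ δ :=
    exists_eLpNorm_indicator_le (by simp) c δpos.ne'
  have hη0 : (η : ℝ≥0∞) ≠ 0 := by simpa using ηpos.ne'
  obtain ⟨K, Ks, K_compact, K_closed, hK⟩ := hs.exists_isCompact_isClosed_sdiff_lt hs'.ne hη0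
  obtain ⟨U, KU, U_open, hU⟩ := K_compact.exists_isOpen_lt_add (μ := ρ) hη0
  obtain ⟨f, f1, f2, f3, f4⟩ := exists_continuousMap_one_of_isCompact_subset_isOpen K_compact
    U_open KU
  have hUK : ρ (U \ K) ≤ η := (measure_sdiff_lt_of_lt_add K_closed.measurableSet.nullMeasurableSet
    KU K_compact.measure_lt_top.ne hU).le
  have hg : Continuous fun z => (f z : ℂ) * c := by fun_prop
  have hgc : HasCompactSupport fun z => (f z : ℂ) * c :=
    (HasCompactSupport.comp_left (g := fun t : ℝ => (t : ℂ)) f2 (by simp)).mul_right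
  refine ⟨fun z => (f z : ℂ) * c, ?_, hg, hgc⟩
  have I1 : eLpNorm ((K.indicator fun _ => c) - s.indicator fun _ => c) 1 ρ ≤ δ := by
    rw [← eLpNorm_neg, neg_sub, ← Set.indicator_sdiff Ks]
    exact hη _ hK.le
  have I2 : eLpNorm ((fun z => (f z : ℂ) * c) - K.indicator fun _ => c) 1 ρ ≤ δ := by
    refine (eLpNorm_mono fun z => ?_).trans (hη _ hUK)
    by_cases hzK : z ∈ K
    · simp [hzK, f1 hzK]
    · by_cases hzU : z ∈ U
      · simp only [Pi.sub_apply, hzK, not_false_eq_true, Set.indicator_of_notMem, sub_zero, norm_mul,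
          Complex.norm_real, Set.mem_sdiff, hzU, and_self, Set.indicator_of_mem]
        rw [Real.norm_of_nonneg (f4 z).1]
        exact mul_le_of_le_one_left (norm_nonneg _) (f4 z).2
      · have : f z = 0 := image_eq_zero_of_notMem_tsupport fun h => hzU (f3 h)
        simp [hzK, this]
  have hKm : AEStronglyMeasurable (K.indicator fun _ : Z => c) ρ :=
    aestronglyMeasurable_const.indicator K_closed.measurableSet
  have := (hδ _ _ (hg.aestronglyMeasurable.sub hKm)
    (hKm.sub (aestronglyMeasurable_const.indicator hs)) I2 I1).le
  simpa only [sub_add_sub_cancel] using this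

theorem denseRange_toL1 [T2Space Z] [LocallyCompactSpace Z] [ρ.InnerRegular] :
    DenseRange (toL1 ρ) := by
  refine fun w => EMetric.mem_closure_iff.2 fun ε hε => ?_
  obtain ⟨δ, δpos, hδ⟩ := exists_between hε
  obtain ⟨g, hg, hgc, hgs⟩ := (Lp.memLp w).induction_dense (by simp)
    (fun g : Z → ℂ => Continuous g ∧ HasCompactSupport g)
    (fun c s hs hs' ε hε => exists_cc_eLpNorm_sub_indicator_le ρ c hs hs' hε)
    (fun f g hf hg => ⟨hf.1.add hg.1, hf.2.add hg.2⟩)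
    (fun f hf => hf.1.aestronglyMeasurable) δpos.ne'
  refine ⟨_, ⟨⟨⟨g, hgc⟩, hgs⟩, rfl⟩, lt_of_le_of_lt ?_ hδ⟩
  rw [Lp.edist_def]
  refine (eLpNorm_congr_ae ?_).trans_le hg
  exact EventuallyEq.rfl.sub (coeFn_toL1 ρ _)

/-- The product of an `L¹` function with a bounded continuous vector valued function is integrable,
without any separability assumption. -/
theorem integrable_smul_of_continuous [T2Space Z] [LocallyCompactSpace Z] [ρ.InnerRegular]
    {X : Type*} [NormedAddCommGroup X] [NormedSpace ℂ X] {V : Z → X} (hV : Continuous V) {C : ℝ}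
    (hC : ∀ z, ‖V z‖ ≤ C) (a : Lp ℂ 1 ρ) : Integrable (fun z => a z • V z) ρ := by
  -- The range of `V` may be non-separable, but `a` is an a.e. limit of functions in `C_c`, and the
  -- product of each of these with `V` is continuous with compact support.
  have hmeas : AEStronglyMeasurable (fun z => a z • V z) ρ := by
    obtain ⟨u, hu, hua⟩ := mem_closure_iff_seq_limit.1 (denseRange_toL1 ρ a)
    choose f hf using hu
    obtain ⟨φ, -, hφ⟩ := (tendstoInMeasure_of_tendsto_Lp hua).exists_seq_tendsto_ae
    refine aestronglyMeasurable_of_tendsto_ae atTop (f := fun n z => f (φ n) z • V z)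
      (fun n => ?_) ?_
    · exact (((f (φ n)).continuous.smul hV).integrable_of_hasCompactSupport
        ((f (φ n)).hasCompactSupport.smul_right)).aestronglyMeasurable
    · have : ∀ᵐ z ∂ρ, ∀ n, u n z = f n z := by
        rw [ae_all_iff]
        intro n
        rw [← hf n]
        exact coeFn_toL1 ρ _
      filter_upwards [hφ, this] with z hz hz'
      simp only [hz'] at hz
      exact hz.smul_const _
  refine ((L1.integrable_coeFn a).norm.mul_const C).mono' hmeas ?_
  filter_upwards with z
  rw [norm_smul]
  gcongr
  exact hC z

/-- A jointly continuous family of functions with locally uniformly compact support is continuous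
for the `L¹` norm. -/
theorem continuous_toL1_of_jointly {Y : Type*} [TopologicalSpace Y] {κ : Y → C_c(Z, ℂ)}
    (hκ : Continuous fun p : Y × Z => κ p.1 p.2)
    (hs : ∀ y₀, ∃ K : Set Z, IsCompact K ∧ ∀ᶠ y in 𝓝 y₀, ∀ z ∉ K, κ y z = 0) :
    Continuous fun y => toL1 ρ (κ y) := by
  refine continuous_iff_continuousAt.2 fun y₀ => ?_
  obtain ⟨K, hK, hy⟩ := hs y₀
  have hc : ContinuousOn (fun y => ∫ z, ‖κ y z - κ y₀ z‖ ∂ρ) {y | ∀ z ∉ K, κ y z = 0} := by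
    refine continuousOn_integral_of_compact_support hK (Continuous.continuousOn ?_) ?_
    · exact (hκ.sub ((κ y₀).continuous.comp continuous_snd)).norm
    · intro y z hy' hz
      simp [hy' z hz, hy.self_of_nhds z hz]
  have hc' := hc.continuousAt hy
  refine tendsto_iff_norm_sub_tendsto_zero.2 ?_
  have : (fun y => ‖toL1 ρ (κ y) - toL1 ρ (κ y₀)‖) = fun y => ∫ z, ‖κ y z - κ y₀ z‖ ∂ρ := by
    funext y
    rw [← toL1_sub, norm_toL1]
    rfl
  rw [this]
  simpa [ContinuousAt] using hc'

/-- The Bochner integral in `L¹` of a jointly continuous compactly supported kernel is given by the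
pointwise integral. -/
theorem integral_toL1_eq {Y : Type*} [TopologicalSpace Y] [MeasurableSpace Y] [BorelSpace Y]
    (σ : Measure Y) [IsFiniteMeasureOnCompacts σ] [T2Space Y] [T2Space Z] {κ : Y → C_c(Z, ℂ)}
    (hκ : Continuous fun p : Y × Z => κ p.1 p.2) {K : Set Z} {L : Set Y} (hK : IsCompact K)
    (hL : IsCompact L) (hκK : ∀ y, ∀ z ∉ K, κ y z = 0) (hκL : ∀ y ∉ L, ∀ z, κ y z = 0) :
    ∃ g : C_c(Z, ℂ), (∀ z, g z = ∫ y, κ y z ∂σ) ∧ ∫ y, toL1 ρ (κ y) ∂σ = toL1 ρ g ∧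
      Integrable (fun y => toL1 ρ (κ y)) σ := by
  have hgc : Continuous fun z => ∫ y, κ y z ∂σ := by
    rw [← continuousOn_univ]
    exact continuousOn_integral_of_compact_support hL
      (hκ.comp continuous_swap).continuousOn fun z y _ hy => hκL y hy z
  have hgs : HasCompactSupport fun z => ∫ y, κ y z ∂σ :=
    HasCompactSupport.intro hK fun z hz => by simp [hκK _ z hz]
  set g : C_c(Z, ℂ) := ⟨⟨_, hgc⟩, hgs⟩
  have hcont : Continuous fun y => toL1 ρ (κ y) :=
    continuous_toL1_of_jointly ρ hκ fun y₀ => ⟨K, hK, Eventually.of_forall hκK⟩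
  have hint : Integrable (fun y => toL1 ρ (κ y)) σ := by
    refine hcont.integrable_of_hasCompactSupport (HasCompactSupport.intro hL fun y hy => ?_)
    have : κ y = 0 := by ext z; exact hκL y hy z
    rw [this]; rfl
  refine ⟨g, fun z => rfl, Lp.ext ?_, hint⟩
  -- Elements of L¹ are determined by their integrals over sets of finite measure; each such
  -- integral passes inside the Bochner integral, leaving a swap for a compactly supported
  -- continuous kernel.
  refine Integrable.ae_eq_of_forall_setIntegral_eq _ _ (L1.integrable_coeFn _)
    (L1.integrable_coeFn _) fun S hS hS' => ?_
  rw [← setIntegral_eq_lpPairing hS hS'.ne, ← ContinuousLinearMap.integral_comp_comm _ hint]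
  simp only [setIntegral_eq_lpPairing]
  rw [integral_congr_ae (ae_restrict_of_ae (coeFn_toL1 ρ g))]
  have h1 : ∀ y, ∫ z in S, toL1 ρ (κ y) z ∂ρ = ∫ z in S, κ y z ∂ρ := fun y =>
    integral_congr_ae (ae_restrict_of_ae (coeFn_toL1 ρ _))
  simp only [h1]
  refine integral_integral_swap_of_hasCompactSupport (f := fun y z => κ y z) hκ ?_
  refine HasCompactSupport.intro (hL.prod hK) ?_
  rintro ⟨y, z⟩ h
  by_cases hy : y ∈ L
  · exact hκK y z fun hz => h ⟨hy, hz⟩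
  · exact hκL y hy z

end L1

/-! ### Integrated forms of families of contractions. -/

section Integrated

theorem norm_apply_le_of_contractive {G X : Type*} [NormedAddCommGroup X] [NormedSpace ℂ X]
    {V : G → X →L[ℂ] X} (hV' : ∀ g, ‖V g‖ ≤ 1) (x : X) (g : G) : ‖V g x‖ ≤ ‖x‖ :=
  ((V g).le_opNorm x).trans (mul_le_of_le_one_left (norm_nonneg _) (hV' g))


variable {G : Type*} [TopologicalSpace G] [T2Space G] [LocallyCompactSpace G] [MeasurableSpace G]
  [BorelSpace G] (μ : Measure G) [IsFiniteMeasureOnCompacts μ] [μ.InnerRegular]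
  {X : Type*} [NormedAddCommGroup X] [NormedSpace ℂ X] {V : G → X →L[ℂ] X}

theorem norm_integral_smul_le {G X : Type*} [MeasurableSpace G] (μ : Measure G)
    [NormedAddCommGroup X] [NormedSpace ℂ X] {V : G → X →L[ℂ] X} (hV' : ∀ g, ‖V g‖ ≤ 1)
    (a : Lp ℂ 1 μ) (x : X) : ‖∫ g, a g • V g x ∂μ‖ ≤ ‖a‖ * ‖x‖ := by
  rw [L1.norm_eq_integral_norm, ← integral_mul_const]
  refine norm_integral_le_of_norm_le ((L1.integrable_coeFn a).norm.mul_const _) ?_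
  filter_upwards with g
  rw [norm_smul]
  gcongr
  exact norm_apply_le_of_contractive hV' x g

/-- The integrated form `a ↦ (x ↦ ∫ a(r) V_r x dr)` of a strongly continuous family of
contractions. -/
def integrated (V : G → X →L[ℂ] X) (hV : ∀ x, Continuous fun g => V g x)
    (hV' : ∀ g, ‖V g‖ ≤ 1) : Lp ℂ 1 μ →L[ℂ] X →L[ℂ] X :=
  have hi : ∀ (a : Lp ℂ 1 μ) (x : X), Integrable (fun g => a g • V g x) μ := fun a x =>
    integrable_smul_of_continuous μ (hV x) (norm_apply_le_of_contractive hV' x) a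
  LinearMap.mkContinuous₂ (LinearMap.mk₂ ℂ (fun a x => ∫ g, a g • V g x ∂μ)
    (fun a b x => by
      rw [← integral_add (hi a x) (hi b x)]
      refine integral_congr_ae ?_
      filter_upwards [Lp.coeFn_add a b] with g hg
      rw [hg, Pi.add_apply, add_smul])
    (fun c a x => by
      rw [← integral_smul]
      refine integral_congr_ae ?_
      filter_upwards [Lp.coeFn_smul c a] with g hg
      rw [hg, Pi.smul_apply, smul_assoc])
    (fun a x y => by
      rw [← integral_add (hi a x) (hi a y)]
      simp only [map_add, smul_add])
    (fun c a x => by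
      rw [← integral_smul]
      simp only [map_smul, smul_comm c])) 1 fun a x => by
    rw [one_mul, LinearMap.mk₂_apply]
    exact norm_integral_smul_le μ hV' a x

theorem integrable_integrated (hV : ∀ x, Continuous fun g => V g x) (hV' : ∀ g, ‖V g‖ ≤ 1)
    (a : Lp ℂ 1 μ) (x : X) :
    Integrable (fun g => a g • V g x) μ :=
  integrable_smul_of_continuous μ (hV x) (norm_apply_le_of_contractive hV' x) a

variable (hV : ∀ x, Continuous fun g => V g x) (hV' : ∀ g, ‖V g‖ ≤ 1)

theorem integrated_apply (a : Lp ℂ 1 μ) (x : X) :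
    integrated μ V hV hV' a x = ∫ g, a g • V g x ∂μ := rfl

theorem integrated_toL1_apply (a : C_c(G, ℂ)) (x : X) :
    integrated μ V hV hV' (toL1 μ a) x = ∫ g, a g • V g x ∂μ := by
  rw [integrated_apply]
  refine integral_congr_ae ?_
  filter_upwards [coeFn_toL1 μ a] with g hg
  rw [hg]

theorem norm_integrated_le (a : Lp ℂ 1 μ) : ‖integrated μ V hV hV' a‖ ≤ ‖a‖ := by
  refine ContinuousLinearMap.opNorm_le_bound _ (norm_nonneg _) fun x => ?_
  rw [integrated_apply]
  exact norm_integral_smul_le μ hV' a x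

theorem clm_integrated [CompleteSpace X] (φ : X →L[ℂ] ℂ) (a : Lp ℂ 1 μ) (x : X) :
    φ (integrated μ V hV hV' a x) = ∫ g, a g * φ (V g x) ∂μ := by
  rw [integrated_apply, ← φ.integral_comp_comm (integrable_integrated μ hV hV' a x)]
  simp only [map_smul, smul_eq_mul]

end Integrated

/-! ### Cohen's factorization theorem. -/

section Factorization

variable {E X : Type*} [NormedAddCommGroup E] [NormedSpace ℂ E] [NormedAddCommGroup X]
  [NormedSpace ℂ X] [CompleteSpace X]

/-- For a contraction `t`, the convex combination `2/3 + t/3` is invertible, with inverse bounded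
by `3`. -/
theorem exists_inverse_convex_comb (t : X →L[ℂ] X) (ht : ‖t‖ ≤ 1) :
    ∃ P : X →L[ℂ] X, ((2 / 3 : ℂ) • 1 + (1 / 3 : ℂ) • t) * P = 1 ∧
      P * ((2 / 3 : ℂ) • 1 + (1 / 3 : ℂ) • t) = 1 ∧ ‖P‖ ≤ 3 := by
  have h1 : ‖(-(1 / 2) : ℂ) • t‖ ≤ 1 / 2 := by
    rw [norm_smul]
    norm_num
    linarith
  -- The combination equals (2/3)(1 + t/2), and ‖t/2‖ < 1.
  let ψ := Units.oneSub ((-(1 / 2) : ℂ) • t) (h1.trans_lt (by norm_num))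
  have hφ : (2 / 3 : ℂ) • 1 + (1 / 3 : ℂ) • t = (2 / 3 : ℂ) • (ψ : X →L[ℂ] X) := by
    rw [Units.val_oneSub, smul_sub, smul_smul, sub_eq_add_neg, ← neg_smul]
    norm_num
  have hψ : ‖(↑ψ⁻¹ : X →L[ℂ] X)‖ ≤ 2 := by
    -- The inverse R satisfies R = 1 - (t/2)R, hence ‖R‖ ≤ 1 + ‖R‖/2.
    have h2 : (↑ψ⁻¹ : X →L[ℂ] X) = 1 + ((-(1 / 2) : ℂ) • t) * ↑ψ⁻¹ := by
      have h3 := ψ.mul_inv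
      rw [Units.val_oneSub, sub_mul, one_mul, sub_eq_iff_eq_add] at h3
      exact h3
    have h4 : ‖(↑ψ⁻¹ : X →L[ℂ] X)‖ ≤ 1 + 1 / 2 * ‖(↑ψ⁻¹ : X →L[ℂ] X)‖ := by
      calc ‖(↑ψ⁻¹ : X →L[ℂ] X)‖ = ‖1 + ((-(1 / 2) : ℂ) • t) * (↑ψ⁻¹ : X →L[ℂ] X)‖ := by rw [← h2]
        _ ≤ ‖(1 : X →L[ℂ] X)‖ + ‖((-(1 / 2) : ℂ) • t)‖ * ‖(↑ψ⁻¹ : X →L[ℂ] X)‖ :=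
          (norm_add_le _ _).trans (by gcongr; exact norm_mul_le _ _)
        _ ≤ _ := by gcongr; exact ContinuousLinearMap.norm_id_le
    linarith
  refine ⟨(3 / 2 : ℂ) • ↑ψ⁻¹, ?_, ?_, ?_⟩
  · rw [hφ, smul_mul_smul_comm, ψ.mul_inv]; norm_num
  · rw [hφ, smul_mul_smul_comm, ψ.inv_mul]; norm_num
  · rw [norm_smul]
    norm_num
    linarith

theorem tendsto_clm_apply {X : Type*} [NormedAddCommGroup X] [NormedSpace ℂ X] {ι : Type*} {l : Filter ι} {A : ι → X →L[ℂ] X} {B : X →L[ℂ] X}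
    {x : ι → X} {y : X} (hA : Tendsto A l (𝓝 B)) (hx : Tendsto x l (𝓝 y)) :
    Tendsto (fun i => A i (x i)) l (𝓝 (B y)) :=
  (isBoundedBilinearMap_apply.continuous.tendsto (B, y)).comp (hA.prodMk_nhds hx)

variable (T : E →L[ℂ] X →L[ℂ] X) {ι : Type*} (l : Filter ι) [l.NeBot] (e : ι → E)

/-- The inductive step of Cohen's factorization: an invertible perturbation `T u + β` of an operator
in the range of `T` is improved to `T u' + 2β/3`, hardly changing the preimage of `x`. -/
theorem factorization_step (he : ∀ i, ‖T (e i)‖ ≤ 1) {x : X}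
    (hx : Tendsto (fun i => T (e i) x) l (𝓝 x)) {u : E} {y : X} {β : ℂ}
    (hu : Tendsto (fun i => T (e i) * T u) l (𝓝 (T u)))
    (hS : IsUnit (T u + β • (1 : X →L[ℂ] X))) (hy : (T u + β • (1 : X →L[ℂ] X)) y = x)
    {ε : ℝ} (hε : 0 < ε) :
    ∃ (i : ι) (y' : X), IsUnit (T (u + (β / 3) • e i) + (2 / 3 * β) • (1 : X →L[ℂ] X)) ∧
      (T (u + (β / 3) • e i) + (2 / 3 * β) • (1 : X →L[ℂ] X)) y' = x ∧ ‖y' - y‖ < ε := by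
  choose P hP1 hP2 hP3 using fun i => exists_inverse_convex_comb (T (e i)) (he i)
  set φ : ι → X →L[ℂ] X := fun i => (2 / 3 : ℂ) • 1 + (1 / 3 : ℂ) • T (e i) with hφ
  -- Since 1 - φ = (1 - T e)/3, one has P - 1 = P(1 - T e)/3; with ‖P‖ ≤ 3, P converges to the
  -- identity wherever T e does.
  have hPu : Tendsto (fun i => P i * T u) l (𝓝 (T u)) := by
    rw [tendsto_iff_norm_sub_tendsto_zero] at hu ⊢
    refine squeeze_zero (fun _ => norm_nonneg _) (fun i => ?_) hu
    have : P i * T u - T u = P i * ((1 / 3 : ℂ) • (T u - T (e i) * T u)) := by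
      have h1 : T u = P i * (φ i * T u) := by rw [← mul_assoc, hP2, one_mul]
      have h2 : φ i * T u = T u - (1 / 3 : ℂ) • (T u - T (e i) * T u) := by
        simp only [hφ, add_mul, smul_mul_assoc, one_mul]
        module
      nth_rewrite 2 [h1]
      rw [← mul_sub, h2, sub_sub_cancel]
    rw [this]
    refine (norm_mul_le _ _).trans ?_
    rw [norm_smul, norm_sub_rev]
    calc _ ≤ 3 * (‖(1 / 3 : ℂ)‖ * ‖T (e i) * T u - T u‖) := by gcongr; exact hP3 i
      _ = _ := by norm_num; ring
  have hPx : Tendsto (fun i => P i x) l (𝓝 x) := by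
    rw [tendsto_iff_norm_sub_tendsto_zero] at hx ⊢
    refine squeeze_zero (fun _ => norm_nonneg _) (fun i => ?_) hx
    have : P i x - x = P i ((1 / 3 : ℂ) • (x - T (e i) x)) := by
      have h1 : x = P i (φ i x) := by
        rw [← mul_apply_eq_comp, hP2]; rfl
      have h2 : φ i x = x - (1 / 3 : ℂ) • (x - T (e i) x) := by
        simp only [hφ, _root_.add_apply, _root_.smul_apply,
          one_apply_eq_self]
        module
      nth_rewrite 2 [h1]
      rw [← map_sub, h2, sub_sub_cancel]
    rw [this]
    refine ((P i).le_opNorm _).trans ?_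
    rw [norm_smul, norm_sub_rev]
    calc _ ≤ 3 * (‖(1 / 3 : ℂ)‖ * ‖T (e i) x - x‖) := by gcongr; exact hP3 i
      _ = _ := by norm_num; ring
  set S := T u + β • (1 : X →L[ℂ] X)
  set M : ι → X →L[ℂ] X := fun i => P i * T u + β • 1 with hM
  have hMS : Tendsto M l (𝓝 S) := hPu.add_const _
  have hMu : ∀ᶠ i in l, IsUnit (M i) := hMS.eventually (Units.isOpen.mem_nhds hS)
  have hinv : Tendsto (fun i => Ring.inverse (M i)) l (𝓝 (Ring.inverse S)) := by
    obtain ⟨s, hs⟩ := hS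
    rw [← hs] at hMS ⊢
    exact (NormedRing.inverse_continuousAt s).tendsto.comp hMS
  have hyy : Tendsto (fun i => Ring.inverse (M i) (P i x)) l (𝓝 y) := by
    have h1 : Ring.inverse S x = y := by
      rw [← hy, ← mul_apply_eq_comp, Ring.inverse_mul_cancel _ hS]; rfl
    rw [← h1]
    exact tendsto_clm_apply hinv hPx
  have hnear := (Metric.tendsto_nhds.1 hyy) ε hε
  obtain ⟨i, hi1, hi2⟩ := (hMu.and hnear).exists
  -- The new operator is T u + βφ, since adding (β/3)e to u and lowering β to 2β/3 produces exactly
  -- β times φ = 2/3 + T e/3. Pulling out φ leaves M = P T u + β, which is close to the invertible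
  -- S.
  have hfac : T (u + (β / 3) • e i) + (2 / 3 * β) • (1 : X →L[ℂ] X) = φ i * M i := by
    have h1 : φ i * M i = T u + β • φ i := by
      simp only [hM]
      rw [mul_add, ← mul_assoc, hP1, one_mul, mul_smul_comm, mul_one]
    rw [h1]
    simp only [hφ, map_add, map_smul]
    module
  refine ⟨i, Ring.inverse (M i) (P i x), ?_, ?_, by rwa [← dist_eq_norm]⟩
  · rw [hfac]
    exact IsUnit.mul ⟨⟨φ i, P i, hP1 i, hP2 i⟩, rfl⟩ hi1
  · rw [hfac, mul_apply_eq_comp, ← mul_apply_eq_comp (M i),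
      Ring.mul_inverse_cancel _ hi1, one_apply_eq_self,
      ← mul_apply_eq_comp, hP1, one_apply_eq_self]

/-- **Cohen's factorization theorem** for a linear family of operators `T` with a bounded
approximate identity. -/
theorem exists_factorization [CompleteSpace E] (hT : ∀ i, ‖T (e i)‖ ≤ 1) (he : ∀ i, ‖e i‖ ≤ 1)
    (hee : ∀ j, Tendsto (fun i => T (e i) * T (e j)) l (𝓝 (T (e j)))) {x : X}
    (hx : Tendsto (fun i => T (e i) x) l (𝓝 x)) : ∃ (a : E) (y : X), T a y = x := by
  -- The scalar part β tends to 0, while the increments (β/3)e of u and the changes of y are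
  -- summable. In the limit T a y = x, although the inverses of the intermediate operators may be
  -- unbounded.
  let β : ℕ → ℂ := fun n => (2 / 3) ^ n
  let St : ℕ → Type _ := fun n => {p : E × X //
    Tendsto (fun i => T (e i) * T p.1) l (𝓝 (T p.1)) ∧
    IsUnit (T p.1 + β n • (1 : X →L[ℂ] X)) ∧ (T p.1 + β n • (1 : X →L[ℂ] X)) p.2 = x}
  have hstep : ∀ n (s : St n), ∃ s' : St (n + 1),
      ‖s'.1.1 - s.1.1‖ ≤ 1 / 3 * (2 / 3) ^ n ∧ ‖s'.1.2 - s.1.2‖ ≤ 1 * (1 / 2) ^ n := by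
    rintro n ⟨⟨u, y⟩, hu, hS, hy⟩
    obtain ⟨i, y', h1, h2, h3⟩ := factorization_step T l e hT hx hu hS hy
      (ε := 1 * (1 / 2) ^ n) (by positivity)
    have hβ : β (n + 1) = 2 / 3 * β n := pow_succ' _ _
    refine ⟨⟨(u + (β n / 3) • e i, y'), ?_, ?_, ?_⟩, ?_, h3.le⟩
    · simp only [map_add, map_smul, mul_add, mul_smul_comm]
      exact hu.add ((hee i).const_smul _)
    · rw [hβ]; exact h1
    · rw [hβ]; exact h2
    · simp only [add_sub_cancel_left, norm_smul]
      calc _ ≤ ‖β n / 3‖ * 1 := by gcongr; exact he i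
        _ = _ := by simp [β]; ring
  choose next hnext using hstep
  -- With u = 0 and β 0 = 1 the operator is the identity, so y = x.
  let s₀ : St 0 := ⟨(0, x), by simp, by simp [β], by simp [β]⟩
  let s : ∀ n, St n := fun n => Nat.rec s₀ (fun n s => next n s) n
  have hs : ∀ n, s (n + 1) = next n (s n) := fun n => rfl
  have hcu : CauchySeq fun n => (s n).1.1 := by
    refine cauchySeq_of_le_geometric (2 / 3) (1 / 3) (by norm_num) fun n => ?_
    rw [dist_comm, dist_eq_norm, hs]
    exact (hnext n (s n)).1
  have hcy : CauchySeq fun n => (s n).1.2 := by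
    refine cauchySeq_of_le_geometric (1 / 2) 1 (by norm_num) fun n => ?_
    rw [dist_comm, dist_eq_norm, hs]
    exact (hnext n (s n)).2
  obtain ⟨a, ha⟩ := cauchySeq_tendsto_of_complete hcu
  obtain ⟨y, hy⟩ := cauchySeq_tendsto_of_complete hcy
  have hβ : Tendsto β atTop (𝓝 0) := tendsto_pow_atTop_nhds_zero_of_norm_lt_one (by norm_num)
  have hlim : Tendsto (fun n => (T (s n).1.1 + β n • (1 : X →L[ℂ] X)) (s n).1.2) atTop
      (𝓝 ((T a + (0 : ℂ) • (1 : X →L[ℂ] X)) y)) :=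
    tendsto_clm_apply (((T.continuous.tendsto a).comp ha).add (hβ.smul_const _)) hy
  have hconst : (fun n => (T (s n).1.1 + β n • (1 : X →L[ℂ] X)) (s n).1.2) = fun _ => x :=
    funext fun n => (s n).2.2.2
  rw [hconst, zero_smul, add_zero] at hlim
  exact ⟨a, y, (tendsto_nhds_unique hlim tendsto_const_nhds)⟩

end Factorization
-- Approximate units on a group and factorization for integrated forms.
section GroupFactorization

variable {G : Type*} [TopologicalSpace G] [Group G] [T2Space G] [LocallyCompactSpace G]
  [MeasurableSpace G] [BorelSpace G] (μ : Measure G) [IsFiniteMeasureOnCompacts μ]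

/-- Compactly supported continuous functions with integral and `L¹` norm equal to `1`. -/
def UnitMass : Type _ := {f : C_c(G, ℂ) // ∫ g, ‖f g‖ ∂μ = 1 ∧ ∫ g, f g ∂μ = 1}

/-- The filter of functions of unit mass whose support shrinks to the neutral element. -/
def shrinking : Filter (UnitMass μ) :=
  (𝓝 (1 : G)).smallSets.comap fun f => Function.support (f.1 : G → ℂ)

theorem eventually_shrinking {U : Set G} (hU : U ∈ 𝓝 (1 : G)) :
    ∀ᶠ f in shrinking μ, ∀ g ∉ U, f.1 g = 0 := by
  have h : ∀ᶠ s in (𝓝 (1 : G)).smallSets, s ⊆ U :=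
    eventually_smallSets.2 ⟨U, hU, fun t ht => ht⟩
  filter_upwards [h.comap _] with f hf g hg
  by_contra h
  exact hg (hf h)

instance shrinking_neBot [IsTopologicalGroup G] [μ.IsOpenPosMeasure] : (shrinking μ).NeBot := by
  refine comap_neBot_iff.2 fun t ht => ?_
  obtain ⟨U, hU, hUt⟩ := (𝓝 (1 : G)).basis_sets.smallSets.mem_iff.1 ht
  obtain ⟨f, f1, f2, f3, f4⟩ := exists_continuousMap_one_of_isCompact_subset_isOpen
    (isCompact_singleton (x := (1 : G))) isOpen_interior
    (Set.singleton_subset_iff.2 (mem_interior_iff_mem_nhds.2 hU))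
  have hpos : 0 < ∫ g, f g ∂μ := f.continuous.integral_pos_of_hasCompactSupport_nonneg_nonzero
    f2 (fun g => (f4 g).1) (x := 1) (by rw [f1 rfl]; exact one_ne_zero)
  set I := ∫ g, f g ∂μ with hI
  have hc : Continuous fun g => ((I⁻¹ * f g : ℝ) : ℂ) := by fun_prop
  have hs : HasCompactSupport fun g => ((I⁻¹ * f g : ℝ) : ℂ) :=
    HasCompactSupport.intro f2 fun g hg => by simp [image_eq_zero_of_notMem_tsupport hg]
  refine ⟨⟨⟨⟨_, hc⟩, hs⟩, ?_, ?_⟩, hUt (show _ ⊆ U from fun g hg => ?_)⟩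
  · have h : ∀ g, ‖((I⁻¹ * f g : ℝ) : ℂ)‖ = I⁻¹ * f g := fun g => by
      rw [Complex.norm_real, Real.norm_of_nonneg (mul_nonneg (inv_nonneg.2 hpos.le) (f4 g).1)]
    change ∫ g, ‖((I⁻¹ * f g : ℝ) : ℂ)‖ ∂μ = 1
    simp only [h]
    rw [integral_const_mul, inv_mul_cancel₀ hpos.ne']
  · change ∫ g, ((I⁻¹ * f g : ℝ) : ℂ) ∂μ = 1
    rw [integral_complex_ofReal, integral_const_mul, inv_mul_cancel₀ hpos.ne', Complex.ofReal_one]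
  · refine interior_subset (f3 (subset_tsupport _ fun h => hg ?_))
    change ((I⁻¹ * f g : ℝ) : ℂ) = 0
    simp [h]

variable [μ.InnerRegular] {X : Type*} [NormedAddCommGroup X] [NormedSpace ℂ X] [CompleteSpace X]
  {V : G → X →L[ℂ] X} (hV : ∀ x, Continuous fun g => V g x) (hV' : ∀ g, ‖V g‖ ≤ 1)

/-- As f has integral 1, the difference is the f-average of V g x - x; the weights have total mass 1
and only g in U count. -/
theorem norm_integrated_sub_le (f : UnitMass μ) {U : Set G} (hf : ∀ g ∉ U, f.1 g = 0) {x : X}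
    {δ : ℝ} (hδ : ∀ g ∈ U, ‖V g x - x‖ ≤ δ) :
    ‖integrated μ V hV hV' (toL1 μ f.1) x - x‖ ≤ δ := by
  have hi : Integrable (fun g => f.1 g • V g x) μ :=
    (f.1.continuous.smul (hV x)).integrable_of_hasCompactSupport f.1.hasCompactSupport.smul_right
  have h : integrated μ V hV hV' (toL1 μ f.1) x - x = ∫ g, f.1 g • (V g x - x) ∂μ := by
    simp only [smul_sub]
    rw [integral_sub hi ((integrable_cc μ f.1).smul_const x), integral_smul_const, f.2.2, one_smul,
      integrated_toL1_apply]
  rw [h]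
  calc _ ≤ ∫ g, ‖f.1 g‖ * δ ∂μ := by
        refine norm_integral_le_of_norm_le ((integrable_cc μ f.1).norm.mul_const _) ?_
        filter_upwards with g
        rw [norm_smul]
        by_cases hg : g ∈ U
        · gcongr
          exact hδ g hg
        · simp [hf g hg]
    _ = δ := by rw [integral_mul_const, f.2.1, one_mul]

/-- Factorization through the integrated form of a strongly continuous family of contractions. -/
theorem exists_integrated_eq [IsTopologicalGroup G] [μ.IsOpenPosMeasure] (h1 : V 1 = 1)
    (hreg : ∀ a : C_c(G, ℂ), Tendsto (fun r => V r * integrated μ V hV hV' (toL1 μ a)) (𝓝 1)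
      (𝓝 (integrated μ V hV hV' (toL1 μ a)))) (x : X) :
    ∃ (a : Lp ℂ 1 μ) (y : X), integrated μ V hV hV' a y = x := by
  have hnorm : ∀ f : UnitMass μ, ‖toL1 μ f.1‖ ≤ 1 := fun f => by rw [norm_toL1, f.2.1]
  refine exists_factorization (integrated μ V hV hV') (shrinking μ) (fun f => toL1 μ f.1)
    (fun f => (norm_integrated_le μ hV hV' _).trans (hnorm f)) hnorm (fun j => ?_) ?_
  · refine Metric.tendsto_nhds.2 fun ε hε => ?_
    have hU := (Metric.tendsto_nhds.1 (hreg j.1)) (ε / 2) (half_pos hε)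
    filter_upwards [eventually_shrinking μ hU] with f hf
    refine lt_of_le_of_lt ?_ (half_lt_self hε)
    rw [dist_eq_norm]
    refine ContinuousLinearMap.opNorm_le_bound _ (half_pos hε).le fun z => ?_
    refine norm_integrated_sub_le μ hV hV' f hf fun g hg => ?_
    have h2 : ‖V g * integrated μ V hV hV' (toL1 μ j.1) - integrated μ V hV hV' (toL1 μ j.1)‖ ≤
        ε / 2 := by
      rw [← dist_eq_norm]
      exact (show dist _ _ < ε / 2 from hg).le
    exact ContinuousLinearMap.le_of_opNorm_le _ h2 z
  · refine Metric.tendsto_nhds.2 fun ε hε => ?_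
    have hU : ∀ᶠ g in 𝓝 (1 : G), dist (V g x) x < ε / 2 := by
      have h2 := (hV x).tendsto 1
      simp only [h1, one_apply_eq_self] at h2
      exact (Metric.tendsto_nhds.1 h2) (ε / 2) (half_pos hε)
    filter_upwards [eventually_shrinking μ hU] with f hf
    refine lt_of_le_of_lt ?_ (half_lt_self hε)
    rw [dist_eq_norm]
    refine norm_integrated_sub_le μ hV hV' f hf fun g hg => ?_
    rw [← dist_eq_norm]
    exact (show dist _ _ < ε / 2 from hg).le

end GroupFactorization

/-! ### Coordinates on G × G. -/

namespace SqGroup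

variable {G : Type*}

/-- The first coordinate. -/
def fst (p : SqGroup G) : G := p.1

/-- The second coordinate. -/
def snd (p : SqGroup G) : G := p.2

@[simp] theorem fst_mk (s t : G) : (mk s t).fst = s := rfl

@[simp] theorem snd_mk (s t : G) : (mk s t).snd = t := rfl

@[simp] theorem mk_fst_snd (p : SqGroup G) : mk p.fst p.snd = p := rfl

@[simp] theorem fst_mul [Group G] (p q : SqGroup G) : (p * q).fst = p.fst * q.fst := rfl

@[simp] theorem snd_mul [Group G] (p q : SqGroup G) : (p * q).snd = p.snd * q.snd := rfl

theorem mk_mul_mk [Group G] (s t s' t' : G) : mk s t * mk s' t' = mk (s * s') (t * t') := rfl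

theorem mk_one_one [Group G] : mk (1 : G) 1 = 1 := rfl

theorem toProdOp_eq (p : SqGroup G) : p.toProdOp = (p.fst, op p.snd) := rfl

variable [TopologicalSpace G]

@[fun_prop]
theorem continuous_fst : Continuous (fst : SqGroup G → G) := _root_.continuous_fst (X := G) (Y := G)

@[fun_prop]
theorem continuous_snd : Continuous (snd : SqGroup G → G) := _root_.continuous_snd (X := G) (Y := G)

@[fun_prop]
theorem continuous_mk {Y : Type*} [TopologicalSpace Y] {f g : Y → G} (hf : Continuous f)
    (hg : Continuous g) : Continuous fun y => mk (f y) (g y) := hf.prodMk hg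

theorem isCompact_prod {K L : Set G} (hK : IsCompact K) (hL : IsCompact L) :
    IsCompact {p : SqGroup G | p.fst ∈ K ∧ p.snd ∈ L} := hK.prod hL

end SqGroup

/-! ### The modular function and Haar measure on G × G. -/

section Haar

open scoped Pointwise

variable {G : Type*} [Group G] [TopologicalSpace G] [IsTopologicalGroup G] [LocallyCompactSpace G]
  [T2Space G] [MeasurableSpace G] [BorelSpace G]
  (μ : Measure G) [μ.IsHaarMeasure] [μ.InnerRegular]

/-- The modular character as a complex valued function. -/
def modC (g : G) : ℂ := ((modularCharacterFun g : ℝ) : ℂ)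

theorem modC_mul (g h : G) : modC (g * h) = modC g * modC h := by
  simp [modC, modularCharacterFun_map_mul]

theorem modC_one : modC (1 : G) = 1 := by
  simp [modC, modularCharacterFun_map_one]

theorem modC_mul_inv (g : G) : modC g * modC g⁻¹ = 1 := by
  rw [← modC_mul, mul_inv_cancel, modC_one]

theorem norm_modC (g : G) : ((‖modC g‖ : ℝ) : ℂ) = modC g := by
  simp [modC]

theorem integral_mul_right_modC_smul {E : Type*} [NormedAddCommGroup E] [NormedSpace ℂ E]
    (f : G → E) (s : G) : ∫ u, f (u * s) ∂μ = modC s • ∫ u, f u ∂μ := by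
  have h := (Homeomorph.mulRight s).measurableEmbedding.integral_map (μ := μ) f
  change ∫ u, f u ∂(map (· * s) μ) = ∫ u, f (u * s) ∂μ at h
  rw [← h, map_right_mul_eq_modularCharacterFun_smul, integral_smul_nnreal_measure, modC,
    Complex.coe_smul, NNReal.smul_def]

theorem integral_mul_right_modC (f : G → ℂ) (s : G) :
    ∫ u, f (u * s) ∂μ = modC s * ∫ u, f u ∂μ :=
  integral_mul_right_modC_smul μ f s

theorem exists_integral_eq_one : ∃ f : C_c(G, ℂ), ∫ g, f g ∂μ = 1 := by
  obtain ⟨f, -⟩ := (eventually_shrinking μ univ_mem).exists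
  exact ⟨f.1, f.2.2⟩

/-- If f in `C_c` has integral 1, then `modC s` = ∫ f(us) du, which is continuous in s because the
supports stay in a compact set locally. -/
theorem continuous_modC (μ : Measure G) [μ.IsHaarMeasure] [μ.InnerRegular] :
    Continuous (modC : G → ℂ) := by
  obtain ⟨f, hf⟩ := exists_integral_eq_one μ
  have h : (modC : G → ℂ) = fun s => ∫ u, f (u * s) ∂μ := by
    funext s
    rw [integral_mul_right_modC, hf, mul_one]
  rw [h]
  refine continuous_iff_continuousAt.2 fun s₀ => ?_
  obtain ⟨N, hN, hs₀⟩ := exists_compact_mem_nhds s₀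
  have hc : ContinuousOn (fun s => ∫ u, f (u * s) ∂μ) N := by
    refine continuousOn_integral_of_compact_support (k := tsupport f * N⁻¹)
      (IsCompact.mul f.hasCompactSupport hN.inv) (Continuous.continuousOn ?_) ?_
    · exact f.continuous.comp (continuous_snd.mul continuous_fst)
    · intro s u hs hu
      refine image_eq_zero_of_notMem_tsupport fun h => hu ?_
      exact ⟨u * s, h, s⁻¹, Set.inv_mem_inv.2 hs, by simp⟩
  exact hc.continuousAt hs₀

/-- Averaging a compactly supported function over the orbits of a subgroup action. -/
theorem integral_mul_integral_eq {H : Type*} [Group H] [TopologicalSpace H] [IsTopologicalGroup H]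
    [T2Space H] [MeasurableSpace H] [BorelSpace H] (σ : Measure H) [IsFiniteMeasureOnCompacts σ]
    [σ.IsMulLeftInvariant] {i : G → H} {π : H → G} (hi : Continuous i) (hπ : Continuous π)
    (hiπ : ∀ u w, π (i u * w) = u * π w) {f : H → ℂ} (hf : Continuous f) (hfs : HasCompactSupport f)
    {g : G → ℂ} (hg : Continuous g) (hgs : HasCompactSupport g) :
    (∫ w, f w ∂σ) * ∫ u, g u ∂μ = ∫ w, g (π w)⁻¹ * ∫ u, f (i u * w) ∂μ ∂σ := by
  have hπK : IsCompact (π '' tsupport f) := IsCompact.image hfs hπ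
  calc (∫ w, f w ∂σ) * ∫ u, g u ∂μ = ∫ w, ∫ u, f w * g ((π w)⁻¹ * u) ∂μ ∂σ := by
        rw [← integral_mul_const]
        refine integral_congr_ae (Eventually.of_forall fun w => ?_)
        simp only
        rw [integral_const_mul, integral_mul_left_eq_self]
    _ = ∫ u, ∫ w, f w * g ((π w)⁻¹ * u) ∂σ ∂μ := by
        refine integral_integral_swap_of_hasCompactSupport
          (f := fun w u => f w * g ((π w)⁻¹ * u)) ?_ ?_
        · simp only [Function.uncurry_def]
          fun_prop
        · refine HasCompactSupport.intro
            (IsCompact.prod hfs (hπK.mul hgs)) fun ⟨w, u⟩ hwu => ?_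
          by_cases hw : w ∈ tsupport f
          · have : g ((π w)⁻¹ * u) = 0 := image_eq_zero_of_notMem_tsupport fun h =>
              hwu ⟨hw, ⟨π w, ⟨w, hw, rfl⟩, (π w)⁻¹ * u, h, by simp⟩⟩
            simp [this]
          · simp [image_eq_zero_of_notMem_tsupport hw]
    _ = ∫ u, ∫ w, g (π w)⁻¹ * f (i u * w) ∂σ ∂μ := by
        refine integral_congr_ae (Eventually.of_forall fun u => ?_)
        simp only
        -- Replacing w by i(u)w turns (π w)⁻¹ u into (π w)⁻¹, by `hiπ`.
        rw [← integral_mul_left_eq_self _ (i u)]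
        simp only [hiπ, mul_inv_rev, inv_mul_cancel_right, mul_comm]
    _ = ∫ w, ∫ u, g (π w)⁻¹ * f (i u * w) ∂μ ∂σ := by
        refine integral_integral_swap_of_hasCompactSupport
          (f := fun u w => g (π w)⁻¹ * f (i u * w)) ?_ ?_
        · simp only [Function.uncurry_def]
          fun_prop
        · have hM : IsCompact (π '' tsupport f * tsupport g) := hπK.mul hgs
          refine HasCompactSupport.intro
            (hM.prod ((hM.image hi).inv.mul hfs)) fun ⟨u, w⟩ huw => ?_
          by_cases hw : (π w)⁻¹ ∈ tsupport g
          · have : f (i u * w) = 0 := image_eq_zero_of_notMem_tsupport fun h => by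
              have hu : u ∈ π '' tsupport f * tsupport g :=
                ⟨π (i u * w), ⟨_, h, rfl⟩, (π w)⁻¹, hw, by simp [hiπ]⟩
              exact huw ⟨hu, (i u)⁻¹, Set.inv_mem_inv.2 ⟨u, hu, rfl⟩, i u * w, h, by simp⟩
            simp [this]
          · simp [image_eq_zero_of_notMem_tsupport hw]
    _ = _ := by simp only [integral_const_mul]

/-- The averaging identity with both maps the identity and ∫ f = 1: the inner integral is then
`modC`. -/
theorem integral_inv_mul_modC {g : G → ℂ} (hg : Continuous g) (hgs : HasCompactSupport g) :
    ∫ s, g s⁻¹ * modC s ∂μ = ∫ s, g s ∂μ := by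
  obtain ⟨f, hf⟩ := exists_integral_eq_one μ
  have h := integral_mul_integral_eq μ μ (i := id) (π := id) (f := f) continuous_id continuous_id
    (fun u w => rfl) f.continuous f.hasCompactSupport hg hgs
  simp only [id, integral_mul_right_modC, hf, mul_one, one_mul] at h
  exact h.symm

variable (ν : Measure (SqGroup G)) [ν.IsHaarMeasure]

theorem continuous_integral_section {f : SqGroup G → ℂ} (hf : Continuous f)
    (hfs : HasCompactSupport f) : Continuous fun t => ∫ s, f (SqGroup.mk s t) ∂μ := by
  rw [← continuousOn_univ]
  refine continuousOn_integral_of_compact_support (k := SqGroup.fst '' tsupport f)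
    (IsCompact.image hfs SqGroup.continuous_fst) (Continuous.continuousOn ?_) ?_
  · exact hf.comp (SqGroup.continuous_mk continuous_snd continuous_fst)
  · exact fun t s _ hs => image_eq_zero_of_notMem_tsupport fun h => hs ⟨_, h, rfl⟩

theorem hasCompactSupport_integral_section {f : SqGroup G → ℂ} (hfs : HasCompactSupport f) :
    HasCompactSupport fun t => ∫ s, f (SqGroup.mk s t) ∂μ := by
  refine HasCompactSupport.intro (IsCompact.image hfs SqGroup.continuous_snd) fun t ht => ?_
  have : ∀ s, f (SqGroup.mk s t) = 0 := fun s =>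
    image_eq_zero_of_notMem_tsupport fun h => ht ⟨_, h, rfl⟩
  simp [this]

/-- A Haar measure on `G × G` is a multiple of the iterated Haar integral. -/
theorem exists_integral_eq_iterated : ∃ c : ℂ, c ≠ 0 ∧ ∀ f : SqGroup G → ℂ, Continuous f →
    HasCompactSupport f → ∫ p, f p ∂ν = c * ∫ t, ∫ s, f (SqGroup.mk s t) ∂μ ∂μ := by
  obtain ⟨g, hg⟩ := exists_integral_eq_one μ
  have hm := continuous_modC μ
  -- Averaging over one coordinate leaves the weight γ in that variable. Doing so in both
  -- coordinates leaves ∫ γ(s)γ(t) dν, which is the constant sought.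
  set γ : G → ℂ := fun s => g s⁻¹ * modC s with hγ
  have hγc : Continuous γ := by fun_prop
  have hγs : HasCompactSupport γ :=
    HasCompactSupport.mul_right (g.hasCompactSupport.comp_homeomorph (Homeomorph.inv G))
  have key : ∀ f : SqGroup G → ℂ, Continuous f → HasCompactSupport f → ∫ p, f p ∂ν =
      (∫ p, γ p.fst * γ p.snd ∂ν) * ∫ t, ∫ s, f (SqGroup.mk s t) ∂μ ∂μ := by
    intro f hf hfs
    set φ : G → ℂ := fun t => ∫ s, f (SqGroup.mk s t) ∂μ with hφ
    have hφc : Continuous φ := continuous_integral_section μ hf hfs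
    have hφs : HasCompactSupport φ := hasCompactSupport_integral_section μ hfs
    have h1 := integral_mul_integral_eq μ ν (i := fun u => SqGroup.mk u 1) (π := SqGroup.fst)
      (g := g)
      (by fun_prop) (by fun_prop) (fun u w => rfl) hf hfs g.continuous g.hasCompactSupport
    have h2 : ∀ p : SqGroup G, ∫ u, f (SqGroup.mk u 1 * p) ∂μ = modC p.fst * φ p.snd := by
      intro p
      rw [hφ, ← integral_mul_right_modC μ (fun s => f (SqGroup.mk s p.snd)) p.fst]
      refine integral_congr_ae (Eventually.of_forall fun u => ?_)
      change f (SqGroup.mk u 1 * SqGroup.mk p.fst p.snd) = _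
      rw [SqGroup.mk_mul_mk, one_mul]
    simp only [h2, hg, mul_one] at h1
    have h3 := integral_mul_integral_eq μ ν (i := fun u => SqGroup.mk 1 u) (π := SqGroup.snd)
      (g := g)
      (f := fun p => γ p.fst * φ p.snd)
      (by fun_prop) (by fun_prop) (fun u w => rfl) (by fun_prop)
      (HasCompactSupport.intro (SqGroup.isCompact_prod hγs hφs) fun p hp => by
        by_cases h : p.fst ∈ tsupport γ
        · simp [image_eq_zero_of_notMem_tsupport fun h' => hp ⟨h, h'⟩]
        · simp [image_eq_zero_of_notMem_tsupport h]) g.continuous g.hasCompactSupport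
    have h4 : ∀ p : SqGroup G, ∫ u, γ (SqGroup.mk 1 u * p).fst * φ (SqGroup.mk 1 u * p).snd ∂μ =
        γ p.fst * (modC p.snd * ∫ t, φ t ∂μ) := by
      intro p
      simp only [SqGroup.fst_mul, SqGroup.snd_mul, SqGroup.fst_mk, SqGroup.snd_mk, one_mul]
      rw [integral_const_mul, integral_mul_right_modC]
    simp only [h4, hg, mul_one] at h3
    calc ∫ p, f p ∂ν = ∫ p, γ p.fst * φ p.snd ∂ν := by
          rw [h1]
          simp only [hγ, mul_assoc]
      _ = _ := by
          rw [h3, ← integral_mul_const]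
          refine integral_congr_ae (Eventually.of_forall fun p => ?_)
          simp only [hγ]
          ring
  refine ⟨_, fun h0 => ?_, key⟩
  -- If the constant vanished, so would the `ν`-integral of every function in `C_c`, even that of a
  -- nonzero nonnegative one.
  obtain ⟨f, f_comp, f_nonneg, f_one⟩ :
    ∃ f : C(SqGroup G, ℝ), HasCompactSupport f ∧ 0 ≤ (f : SqGroup G → ℝ) ∧ f 1 ≠ 0 :=
    exists_continuous_nonneg_pos 1
  have hpos := f.continuous.integral_pos_of_hasCompactSupport_nonneg_nonzero (μ := ν) f_comp
    f_nonneg f_one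
  have h1 := key (fun p => (f p : ℂ)) (by fun_prop)
    (HasCompactSupport.comp_left (g := fun t : ℝ => (t : ℂ)) f_comp (by simp))
  rw [h0, zero_mul, integral_complex_ofReal] at h1
  exact hpos.ne' (by exact_mod_cast h1)

/-- Translating a function of integral 1 by (1, q) and computing its integral through the iterated
integral scales only the outer variable, by `modC q`. -/
theorem modC_mk_one (μ : Measure G) [μ.IsHaarMeasure] [μ.InnerRegular]
    (ν : Measure (SqGroup G)) [ν.IsHaarMeasure] [ν.InnerRegular] (q : G) :
    modC (SqGroup.mk 1 q) = modC q := by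
  obtain ⟨f, hf⟩ := exists_integral_eq_one ν
  obtain ⟨c, hc, key⟩ := exists_integral_eq_iterated μ ν
  have h1 := integral_mul_right_modC ν f (SqGroup.mk 1 q)
  rw [hf, mul_one, key (fun p => f (p * SqGroup.mk 1 q)) (by fun_prop)
    (f.hasCompactSupport.comp_homeomorph (Homeomorph.mulRight (SqGroup.mk 1 q)))] at h1
  simp only [SqGroup.mk_mul_mk, mul_one] at h1
  rw [integral_mul_right_modC μ (fun t => ∫ s, f (SqGroup.mk s t) ∂μ) q, mul_left_comm,
    ← key f f.continuous f.hasCompactSupport, hf, mul_one] at h1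
  exact h1.symm

end Haar

/-! ### Strong continuity of translations and the module actions on L¹(G × G). -/

section Translations

variable {G : Type*} [Group G] [TopologicalSpace G] [IsTopologicalGroup G] [LocallyCompactSpace G]
  [T2Space G] [MeasurableSpace G] [BorelSpace G]
  (μ : Measure G) [μ.IsHaarMeasure] [μ.InnerRegular]

/-- The left translate `y ↦ f (q⁻¹ y)` of a compactly supported function. -/
def ccLeft {H : Type*} [Group H] [TopologicalSpace H] [IsTopologicalGroup H] (q : H)
    (f : C_c(H, ℂ)) : C_c(H, ℂ) :=
  ⟨⟨fun y => f (q⁻¹ * y), by fun_prop⟩,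
    f.hasCompactSupport.comp_homeomorph (Homeomorph.mulLeft q⁻¹)⟩

/-- The right translate `x ↦ Δ(q)⁻¹ f (x q⁻¹)` of a compactly supported function, normalized to
preserve integrals. -/
def ccRight {H : Type*} [Group H] [TopologicalSpace H] [IsTopologicalGroup H]
    [LocallyCompactSpace H] (q : H) (f : C_c(H, ℂ)) : C_c(H, ℂ) :=
  ⟨⟨fun x => modC q * f (x * q⁻¹), by fun_prop⟩,
    (f.hasCompactSupport.comp_homeomorph (Homeomorph.mulRight q⁻¹)).mul_left⟩

section

variable {H : Type*} [Group H] [TopologicalSpace H] [IsTopologicalGroup H]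

theorem ccLeft_apply (q : H) (f : C_c(H, ℂ)) (y : H) : ccLeft q f y = f (q⁻¹ * y) := rfl

theorem ccRight_apply [LocallyCompactSpace H] (q : H) (f : C_c(H, ℂ)) (x : H) :
    ccRight q f x = modC q * f (x * q⁻¹) := rfl

theorem ccLeft_one (f : C_c(H, ℂ)) : ccLeft 1 f = f := by
  ext y; simp [ccLeft_apply]

variable [LocallyCompactSpace H] [T2Space H] [MeasurableSpace H] [BorelSpace H]
  (σ : Measure H) [σ.IsHaarMeasure]

theorem ccRight_one (f : C_c(H, ℂ)) : ccRight 1 f = f := by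
  ext y; simp [ccRight_apply, modC_one]

open scoped Pointwise in
theorem continuous_toL1_ccLeft (f : C_c(H, ℂ)) : Continuous fun q => toL1 σ (ccLeft q f) := by
  refine continuous_toL1_of_jointly σ ?_ fun q₀ => ?_
  · simp only [ccLeft_apply]
    fun_prop
  · obtain ⟨N, hN, hq⟩ := exists_compact_mem_nhds q₀
    refine ⟨N * tsupport f, hN.mul f.hasCompactSupport, ?_⟩
    filter_upwards [hq] with q hqN y hy
    exact image_eq_zero_of_notMem_tsupport (f := f) fun h => hy ⟨q, hqN, q⁻¹ * y, h, by simp⟩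

open scoped Pointwise in
theorem continuous_toL1_ccRight [σ.InnerRegular] (f : C_c(H, ℂ)) :
    Continuous fun q => toL1 σ (ccRight q f) := by
  have hm := continuous_modC σ
  refine continuous_toL1_of_jointly σ ?_ fun q₀ => ?_
  · simp only [ccRight_apply]
    fun_prop
  · obtain ⟨N, hN, hq⟩ := exists_compact_mem_nhds q₀
    refine ⟨tsupport f * N, IsCompact.mul f.hasCompactSupport hN, ?_⟩
    filter_upwards [hq] with q hqN y hy
    rw [ccRight_apply, image_eq_zero_of_notMem_tsupport fun h => hy ⟨y * q⁻¹, h, q, hqN, by simp⟩,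
      mul_zero]

end

variable (ν : Measure (SqGroup G)) [ν.IsHaarMeasure] [ν.InnerRegular]

/-- `leftTranslate` as a continuous linear map. -/
def leftTranslateL (r : G) : Lp ℂ 1 ν →L[ℂ] Lp ℂ 1 ν :=
  (Lp.compMeasurePreservingₗᵢ ℂ (fun p => SqGroup.mk r⁻¹ 1 * p)
    (measurePreserving_mul_left ν (SqGroup.mk r⁻¹ 1))).toContinuousLinearMap

theorem leftTranslateL_apply (r : G) (w : Lp ℂ 1 ν) :
    leftTranslateL ν r w = leftTranslate ν r w := rfl

theorem norm_leftTranslateL_le (r : G) : ‖leftTranslateL ν r‖ ≤ 1 :=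
  LinearIsometry.norm_toContinuousLinearMap_le _

theorem ae_mul_right {P : SqGroup G → Prop} (hP : ∀ᵐ p ∂ν, P p) (h : SqGroup G) :
    ∀ᵐ p ∂ν, P (p * h) := by
  have hq : QuasiMeasurePreserving (fun p => p * h) ν ν := by
    refine ⟨measurable_mul_const _, ?_⟩
    rw [map_right_mul_eq_modularCharacterFun_smul]
    exact smul_absolutelyContinuous
  exact hq.ae hP

theorem coeFn_rightTranslate (q : G) (w : Lp ℂ 1 ν) :
    rightTranslate ν q w =ᵐ[ν] fun p => modC q * w (p * SqGroup.mk 1 q⁻¹) :=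
  MemLp.coeFn_toLp _

theorem rightTranslate_eq_of_ae (q : G) {w w' : Lp ℂ 1 ν}
    (h : w' =ᵐ[ν] fun p => modC q * w (p * SqGroup.mk 1 q⁻¹)) : rightTranslate ν q w = w' :=
  Lp.ext ((coeFn_rightTranslate ν q w).trans h.symm)

/-- Translation by (1, q⁻¹) scales integrals by `modC q⁻¹`, which cancels the factor `modC q` built
into `rightTranslate`. -/
theorem norm_rightTranslate (μ : Measure G) [μ.IsHaarMeasure] [μ.InnerRegular]
    (ν : Measure (SqGroup G)) [ν.IsHaarMeasure] [ν.InnerRegular] (q : G) (w : Lp ℂ 1 ν) :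
    ‖rightTranslate ν q w‖ = ‖w‖ := by
  have h0 : ∫ p, ‖rightTranslate ν q w p‖ ∂ν = ∫ p, ‖modC q * w (p * SqGroup.mk 1 q⁻¹)‖ ∂ν :=
    integral_congr_ae ((coeFn_rightTranslate ν q w).fun_comp norm)
  have h : ((‖rightTranslate ν q w‖ : ℝ) : ℂ) = ((‖w‖ : ℝ) : ℂ) := by
    rw [L1.norm_eq_integral_norm, L1.norm_eq_integral_norm, h0, ← integral_complex_ofReal,
      ← integral_complex_ofReal]
    simp only [norm_mul, Complex.ofReal_mul, norm_modC]
    rw [integral_const_mul,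
      integral_mul_right_modC ν (fun p => ((‖w p‖ : ℝ) : ℂ)) (SqGroup.mk 1 q⁻¹), ← mul_assoc]
    rw [modC_mk_one μ ν, modC_mul_inv, one_mul]
  exact_mod_cast h

/-- `rightTranslate` as a continuous linear map. -/
def rightTranslateL (q : G) : Lp ℂ 1 ν →L[ℂ] Lp ℂ 1 ν :=
  LinearMap.mkContinuous
    { toFun := rightTranslate ν q
      map_add' := fun w w' => by
        refine rightTranslate_eq_of_ae ν q ?_
        filter_upwards [Lp.coeFn_add (rightTranslate ν q w) (rightTranslate ν q w'),
          coeFn_rightTranslate ν q w, coeFn_rightTranslate ν q w',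
          ae_mul_right ν (Lp.coeFn_add w w') (SqGroup.mk 1 q⁻¹)] with p h1 h2 h3 h4
        rw [h1, Pi.add_apply, h2, h3, h4, Pi.add_apply, mul_add]
      map_smul' := fun c w => by
        refine rightTranslate_eq_of_ae ν q ?_
        filter_upwards [Lp.coeFn_smul c (rightTranslate ν q w), coeFn_rightTranslate ν q w,
          ae_mul_right ν (Lp.coeFn_smul c w) (SqGroup.mk 1 q⁻¹)] with p h1 h2 h3
        rw [RingHom.id_apply, h1, Pi.smul_apply, h2, h3, Pi.smul_apply, smul_eq_mul, smul_eq_mul,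
          mul_left_comm] } 1 fun w => by
    rw [one_mul]
    exact (norm_rightTranslate μ ν q w).le

theorem rightTranslateL_apply (q : G) (w : Lp ℂ 1 ν) :
    rightTranslateL μ ν q w = rightTranslate ν q w := rfl

theorem norm_rightTranslateL_le (q : G) : ‖rightTranslateL μ ν q‖ ≤ 1 :=
  LinearMap.mkContinuous_norm_le _ zero_le_one _

theorem leftTranslate_toL1 (r : G) (w : C_c(SqGroup G, ℂ)) :
    leftTranslate ν r (toL1 ν w) = toL1 ν (ccLeft (SqGroup.mk r 1) w) := by
  have h : SqGroup.mk r⁻¹ 1 = (SqGroup.mk r 1)⁻¹ :=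
    eq_inv_of_mul_eq_one_left (by rw [SqGroup.mk_mul_mk, inv_mul_cancel, one_mul]; rfl)
  refine (Lp.toLp_compMeasurePreserving _ _).trans ?_
  refine MemLp.toLp_congr _ _ (Eventually.of_forall fun p => ?_)
  simp only [Function.comp_apply, ccLeft_apply, h]

theorem rightTranslate_toL1 (μ : Measure G) [μ.IsHaarMeasure] [μ.InnerRegular]
    (ν : Measure (SqGroup G)) [ν.IsHaarMeasure] [ν.InnerRegular] (q : G) (w : C_c(SqGroup G, ℂ)) :
    rightTranslate ν q (toL1 ν w) = toL1 ν (ccRight (SqGroup.mk 1 q) w) := by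
  have h : SqGroup.mk 1 q⁻¹ = (SqGroup.mk 1 q)⁻¹ :=
    eq_inv_of_mul_eq_one_left (by rw [SqGroup.mk_mul_mk, inv_mul_cancel, one_mul]; rfl)
  refine rightTranslate_eq_of_ae ν q ?_
  filter_upwards [coeFn_toL1 ν (ccRight (SqGroup.mk 1 q) w),
    ae_mul_right ν (coeFn_toL1 ν w) (SqGroup.mk 1 q⁻¹)] with p h1 h2
  rw [h1, h2, ccRight_apply, modC_mk_one μ ν, h]

/-- Strong continuity of a family of contractions can be tested on `C_c`. -/
theorem continuous_of_forall_toL1 {Y Z : Type*} [TopologicalSpace Y] [TopologicalSpace Z]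
    [MeasurableSpace Z] [BorelSpace Z] [T2Space Z] [LocallyCompactSpace Z] (σ : Measure Z)
    [IsFiniteMeasureOnCompacts σ] [σ.InnerRegular] {V : Y → Lp ℂ 1 σ →L[ℂ] Lp ℂ 1 σ}
    (hV' : ∀ y, ‖V y‖ ≤ 1) (hV : ∀ f : C_c(Z, ℂ), Continuous fun y => V y (toL1 σ f))
    (w : Lp ℂ 1 σ) : Continuous fun y => V y w := by
  -- Contractivity makes the orbit map of w a uniform limit of orbit maps of functions in `C_c`.
  refine continuous_of_uniform_approx_of_continuous fun u hu => ?_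
  obtain ⟨ε, hε, hεu⟩ := Metric.mem_uniformity_dist.1 hu
  obtain ⟨f, hf⟩ := (denseRange_toL1 σ).exists_dist_lt w hε
  refine ⟨_, hV f, fun y => hεu ?_⟩
  rw [dist_eq_norm, ← map_sub]
  refine (norm_apply_le_of_contractive hV' _ _).trans_lt ?_
  rwa [← dist_eq_norm]

theorem continuous_leftTranslateL (w : Lp ℂ 1 ν) : Continuous fun r => leftTranslateL ν r w := by
  refine continuous_of_forall_toL1 ν (norm_leftTranslateL_le ν) (fun f => ?_) w
  simp only [leftTranslateL_apply, leftTranslate_toL1]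
  exact (continuous_toL1_ccLeft ν f).comp (by fun_prop : Continuous fun r : G => SqGroup.mk r 1)

theorem continuous_rightTranslateL (w : Lp ℂ 1 ν) :
    Continuous fun q => rightTranslateL μ ν q w := by
  refine continuous_of_forall_toL1 ν (norm_rightTranslateL_le μ ν) (fun f => ?_) w
  simp only [rightTranslateL_apply, rightTranslate_toL1 μ]
  exact (continuous_toL1_ccRight ν f).comp (by fun_prop : Continuous fun q : G => SqGroup.mk 1 q)

/-- `leftAct` as a continuous bilinear map. -/
def leftActL : Lp ℂ 1 μ →L[ℂ] Lp ℂ 1 ν →L[ℂ] Lp ℂ 1 ν :=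
  integrated μ (leftTranslateL ν) (continuous_leftTranslateL ν) (norm_leftTranslateL_le ν)

/-- `rightAct` as a continuous bilinear map. -/
def rightActL : Lp ℂ 1 μ →L[ℂ] Lp ℂ 1 ν →L[ℂ] Lp ℂ 1 ν :=
  integrated μ (rightTranslateL μ ν) (continuous_rightTranslateL μ ν)
    (norm_rightTranslateL_le μ ν)

theorem leftActL_apply (b : Lp ℂ 1 μ) (w : Lp ℂ 1 ν) : leftActL μ ν b w = leftAct μ ν b w := rfl

theorem rightActL_apply (a : Lp ℂ 1 μ) (w : Lp ℂ 1 ν) : rightActL μ ν a w = rightAct μ ν w a := rfl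

theorem leftAct_toL1 (b : C_c(G, ℂ)) (w : C_c(SqGroup G, ℂ)) :
    ∃ g : C_c(SqGroup G, ℂ), (∀ p, g p = ∫ r, b r * w (SqGroup.mk r⁻¹ 1 * p) ∂μ) ∧
      leftAct μ ν (toL1 μ b) (toL1 ν w) = toL1 ν g := by
  have h : ∀ r : G, (SqGroup.mk r 1)⁻¹ = SqGroup.mk r⁻¹ 1 := fun r =>
    inv_eq_of_mul_eq_one_left (by rw [SqGroup.mk_mul_mk, inv_mul_cancel, one_mul]; rfl)
  have hK : IsCompact ((fun x : G × SqGroup G => SqGroup.mk x.1 1 * x.2) ''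
      (tsupport b ×ˢ tsupport w)) :=
    (IsCompact.prod b.hasCompactSupport w.hasCompactSupport).image (by fun_prop)
  obtain ⟨g, hg1, hg2, -⟩ := integral_toL1_eq ν μ
    (κ := fun r => b r • ccLeft (SqGroup.mk r 1) w) (by
      simp only [CompactlySupportedContinuousMap.smul_apply, ccLeft_apply]
      fun_prop) hK b.hasCompactSupport (fun r p hp => by
      rw [CompactlySupportedContinuousMap.smul_apply, ccLeft_apply]
      by_cases hr : r ∈ tsupport b
      · rw [image_eq_zero_of_notMem_tsupport (f := w) fun h' => hp ⟨(r, _), ⟨hr, h'⟩, by simp⟩,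
          smul_zero]
      · rw [image_eq_zero_of_notMem_tsupport hr, zero_smul]) (fun r hr p => by
      rw [CompactlySupportedContinuousMap.smul_apply, image_eq_zero_of_notMem_tsupport hr,
        zero_smul])
  refine ⟨g, fun p => ?_, ?_⟩
  · rw [hg1]
    simp only [CompactlySupportedContinuousMap.smul_apply, ccLeft_apply, h, smul_eq_mul]
  · rw [← hg2, ← leftActL_apply, leftActL, integrated_toL1_apply]
    simp only [leftTranslateL_apply, leftTranslate_toL1]
    rfl

theorem rightAct_toL1 (a : C_c(G, ℂ)) (w : C_c(SqGroup G, ℂ)) :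
    ∃ g : C_c(SqGroup G, ℂ), (∀ p, g p = ∫ q, a q * (modC q * w (p * SqGroup.mk 1 q⁻¹)) ∂μ) ∧
      rightAct μ ν (toL1 ν w) (toL1 μ a) = toL1 ν g := by
  have h : ∀ r : G, (SqGroup.mk 1 r)⁻¹ = SqGroup.mk 1 r⁻¹ := fun r =>
    inv_eq_of_mul_eq_one_left (by rw [SqGroup.mk_mul_mk, inv_mul_cancel, one_mul]; rfl)
  have hm := continuous_modC ν
  have hK : IsCompact ((fun x : G × SqGroup G => x.2 * SqGroup.mk 1 x.1) ''
      (tsupport a ×ˢ tsupport w)) :=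
    (IsCompact.prod a.hasCompactSupport w.hasCompactSupport).image (by fun_prop)
  obtain ⟨g, hg1, hg2, -⟩ := integral_toL1_eq ν μ
    (κ := fun r => a r • ccRight (SqGroup.mk 1 r) w) (by
      simp only [CompactlySupportedContinuousMap.smul_apply, ccRight_apply]
      fun_prop) hK a.hasCompactSupport (fun r p hp => by
      rw [CompactlySupportedContinuousMap.smul_apply, ccRight_apply]
      by_cases hr : r ∈ tsupport a
      · rw [image_eq_zero_of_notMem_tsupport (f := w) fun h' => hp ⟨(r, _), ⟨hr, h'⟩, by simp⟩,
          mul_zero, smul_zero]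
      · rw [image_eq_zero_of_notMem_tsupport hr, zero_smul]) (fun r hr p => by
      rw [CompactlySupportedContinuousMap.smul_apply, image_eq_zero_of_notMem_tsupport hr,
        zero_smul])
  refine ⟨g, fun p => ?_, ?_⟩
  · rw [hg1]
    simp only [CompactlySupportedContinuousMap.smul_apply, ccRight_apply, h, smul_eq_mul,
      modC_mk_one μ ν]
  · rw [← hg2, ← rightActL_apply, rightActL, integrated_toL1_apply]
    simp only [rightTranslateL_apply, rightTranslate_toL1 μ]
    rfl

/-- The two sided action on `C_c`, written as an iterated integral against a product kernel. -/
theorem rightAct_leftAct_toL1 (a b : C_c(G, ℂ)) (w : C_c(SqGroup G, ℂ)) :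
    ∃ g : C_c(SqGroup G, ℂ), (∀ p, g p = ∫ t, ∫ s, w (SqGroup.mk s t) *
        (b (p.fst * s⁻¹) * modC s * a (t⁻¹ * p.snd)) ∂μ ∂μ) ∧
      rightAct μ ν (leftAct μ ν (toL1 μ b) (toL1 ν w)) (toL1 μ a) = toL1 ν g := by
  obtain ⟨g₁, h1, h2⟩ := leftAct_toL1 μ ν b w
  obtain ⟨g₂, h3, h4⟩ := rightAct_toL1 μ ν a g₁
  refine ⟨g₂, fun p => ?_, by rw [h2, h4]⟩
  -- Substitute r = p.fst * s⁻¹: a left shift, then an inversion, which brings in `modC s`.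
  have hleft : ∀ t, g₁ (SqGroup.mk p.fst t) =
      ∫ s, b (p.fst * s⁻¹) * w (SqGroup.mk s t) * modC s ∂μ := by
    intro t
    rw [h1, ← integral_mul_left_eq_self _ p.fst]
    have hc : HasCompactSupport fun s => b (p.fst * s⁻¹) * w (SqGroup.mk s t) :=
      HasCompactSupport.mul_right (b.hasCompactSupport.comp_homeomorph
        ((Homeomorph.inv G).trans (Homeomorph.mulLeft p.fst)))
    have hm := continuous_modC μ
    have h5 := integral_inv_mul_modC μ (g := fun s => b (p.fst * s⁻¹) * w (SqGroup.mk s t) * modC s)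
      (by fun_prop) hc.mul_right
    rw [← h5]
    refine integral_congr_ae (Eventually.of_forall fun s => ?_)
    simp only [SqGroup.mk_mul_mk, mul_inv_rev, inv_mul_cancel_right, one_mul, inv_inv]
    rw [mul_assoc, mul_comm (modC s⁻¹), modC_mul_inv, mul_one]
  -- Substitute q = t⁻¹ * p.snd; here the inversion absorbs the `modC q` already present in the
  -- right action.
  have hright : g₂ p = ∫ t, a (t⁻¹ * p.snd) * g₁ (SqGroup.mk p.fst t) ∂μ := by
    have hc : HasCompactSupport fun s => a s⁻¹ * g₁ (SqGroup.mk p.fst (p.snd * s)) :=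
      HasCompactSupport.mul_right (a.hasCompactSupport.comp_homeomorph (Homeomorph.inv G))
    have h5 := integral_inv_mul_modC μ
      (g := fun s => a s⁻¹ * g₁ (SqGroup.mk p.fst (p.snd * s))) (by fun_prop) hc
    rw [h3, ← integral_mul_left_eq_self (fun t => a (t⁻¹ * p.snd) * _) p.snd]
    simp only [mul_inv_rev, inv_mul_cancel_right]
    rw [← h5]
    refine integral_congr_ae (Eventually.of_forall fun q => ?_)
    simp only [inv_inv]
    rw [← SqGroup.mk_fst_snd p, SqGroup.mk_mul_mk, mul_one]
    simp only [SqGroup.fst_mk, SqGroup.snd_mk]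
    ring
  rw [hright]
  refine integral_congr_ae (Eventually.of_forall fun t => ?_)
  simp only
  rw [hleft, ← integral_const_mul]
  refine integral_congr_ae (Eventually.of_forall fun s => ?_)
  simp only
  ring

end Translations

/-! ### Products a·F·b are left uniformly continuous. -/

section Smoothing

variable {G : Type*} [Group G] [TopologicalSpace G] [IsTopologicalGroup G] [LocallyCompactSpace G]
  [T2Space G] [MeasurableSpace G] [BorelSpace G]
  (μ : Measure G) [μ.IsHaarMeasure] [μ.InnerRegular]
  (ν : Measure (SqGroup G)) [ν.IsHaarMeasure] [ν.InnerRegular]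

/-- The factor relating a Haar measure on `G × G` to the iterated Haar integral. -/
def iterConst (μ : Measure G) [μ.IsHaarMeasure] [μ.InnerRegular] (ν : Measure (SqGroup G))
    [ν.IsHaarMeasure] : ℂ := (exists_integral_eq_iterated μ ν).choose

theorem iterConst_ne_zero : iterConst μ ν ≠ 0 := (exists_integral_eq_iterated μ ν).choose_spec.1

theorem integral_eq_iterated {f : SqGroup G → ℂ} (hf : Continuous f) (hfs : HasCompactSupport f) :
    ∫ p, f p ∂ν = iterConst μ ν * ∫ t, ∫ s, f (SqGroup.mk s t) ∂μ ∂μ :=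
  (exists_integral_eq_iterated μ ν).choose_spec.2 f hf hfs

section Support

open scoped Pointwise

/-- One compact set supports the kernels for all p in a compact N. This yields both their
L¹-continuity in p and their integrability against a function supported in N. -/
theorem prodKernel_support (b a : C_c(G, ℂ)) {N : Set (SqGroup G)} {p : SqGroup G} (hp : p ∈ N)
    {z : SqGroup G} (hz : ¬(z.fst ∈ tsupport b * SqGroup.fst '' N ∧
      z.snd ∈ SqGroup.snd '' N * tsupport a)) :
    b (z.fst * p.fst⁻¹) * modC p.fst * a (p.snd⁻¹ * z.snd) = 0 := by
  by_cases h : z.fst * p.fst⁻¹ ∈ tsupport b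
  · have h0 : a (p.snd⁻¹ * z.snd) = 0 := image_eq_zero_of_notMem_tsupport fun h' => hz
      ⟨⟨_, h, p.fst, ⟨p, hp, rfl⟩, by simp⟩, ⟨p.snd, ⟨p, hp, rfl⟩, _, h', by simp⟩⟩
    rw [h0, mul_zero]
  · rw [image_eq_zero_of_notMem_tsupport h, zero_mul, zero_mul]

theorem isCompact_prodKernel_support (b a : C_c(G, ℂ)) {N : Set (SqGroup G)} (hN : IsCompact N) :
    IsCompact {z : SqGroup G | z.fst ∈ tsupport b * SqGroup.fst '' N ∧
      z.snd ∈ SqGroup.snd '' N * tsupport a} :=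
  SqGroup.isCompact_prod (IsCompact.mul b.hasCompactSupport (hN.image SqGroup.continuous_fst))
    ((hN.image SqGroup.continuous_snd).mul a.hasCompactSupport)

end Support

/-- The product of a right translate of `b` and a left translate of `a`. -/
def prodKernel (b a : C_c(G, ℂ)) (p : SqGroup G) : C_c(SqGroup G, ℂ) :=
  ⟨⟨fun z => b (z.fst * p.fst⁻¹) * modC p.fst * a (p.snd⁻¹ * z.snd), by fun_prop⟩,
    HasCompactSupport.intro (isCompact_prodKernel_support b a isCompact_singleton) fun _ hz =>
      prodKernel_support b a (Set.mem_singleton p) hz⟩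

theorem prodKernel_apply (b a : C_c(G, ℂ)) (p z : SqGroup G) :
    prodKernel b a p z = b (z.fst * p.fst⁻¹) * modC p.fst * a (p.snd⁻¹ * z.snd) := rfl

theorem prodKernel_sub_left (b b' a : C_c(G, ℂ)) (p : SqGroup G) :
    prodKernel (b - b') a p = prodKernel b a p - prodKernel b' a p := by
  ext z
  simp only [prodKernel_apply, CompactlySupportedContinuousMap.sub_apply]
  ring

theorem prodKernel_sub_right (b a a' : C_c(G, ℂ)) (p : SqGroup G) :
    prodKernel b (a - a') p = prodKernel b a p - prodKernel b a' p := by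
  ext z
  simp only [prodKernel_apply, CompactlySupportedContinuousMap.sub_apply]
  ring

/-- Left translation of the parameter in G × Gᵒᵖ is thereby traded for translations of b and a,
which are continuous in L¹(G). -/
theorem prodKernel_translate (b a : C_c(G, ℂ)) (r q s t : G) :
    prodKernel (ccRight r b) (ccLeft q a) (SqGroup.mk s t) =
      prodKernel b a (SqGroup.mk (r * s) (t * q)) := by
  ext z
  simp only [prodKernel_apply, ccRight_apply, ccLeft_apply, SqGroup.fst_mk, SqGroup.snd_mk,
    mul_inv_rev, modC_mul, mul_assoc]
  ring

theorem continuous_toL1_prodKernel (μ : Measure G) [μ.IsHaarMeasure] [μ.InnerRegular]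
    (ν : Measure (SqGroup G)) [ν.IsHaarMeasure] (b a : C_c(G, ℂ)) :
    Continuous fun p => toL1 ν (prodKernel b a p) := by
  have hm := continuous_modC μ
  refine continuous_toL1_of_jointly ν ?_ fun p₀ => ?_
  · simp only [prodKernel_apply]
    fun_prop
  · obtain ⟨N, hN, hp⟩ := exists_compact_mem_nhds p₀
    refine ⟨_, isCompact_prodKernel_support b a hN, ?_⟩
    filter_upwards [hp] with p hpN z hz
    exact prodKernel_support b a hpN hz

/-- The norm does not depend on p: `modC p.fst` makes the right translation of b isometric, and the
left translation of a already is. This bounds `smoothing` uniformly. -/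
theorem norm_toL1_prodKernel (b a : C_c(G, ℂ)) (p : SqGroup G) :
    ‖toL1 ν (prodKernel b a p)‖ = ‖iterConst μ ν‖ * (‖toL1 μ b‖ * ‖toL1 μ a‖) := by
  have h : ((‖toL1 ν (prodKernel b a p)‖ : ℝ) : ℂ) =
      iterConst μ ν * (((‖toL1 μ b‖ * ‖toL1 μ a‖ : ℝ)) : ℂ) := by
    rw [norm_toL1, norm_toL1, norm_toL1, Complex.ofReal_mul, ← integral_complex_ofReal,
      ← integral_complex_ofReal, ← integral_complex_ofReal,
      integral_eq_iterated μ ν (f := fun z => ((‖prodKernel b a p z‖ : ℝ) : ℂ)) (by fun_prop)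
        ((prodKernel b a p).hasCompactSupport.comp_left (g := fun x => ((‖x‖ : ℝ) : ℂ)) (by simp))]
    simp only [prodKernel_apply, SqGroup.fst_mk, SqGroup.snd_mk, norm_mul, Complex.ofReal_mul,
      norm_modC, integral_mul_const, integral_const_mul]
    rw [integral_mul_right_modC μ (fun s => ((‖b s‖ : ℝ) : ℂ)),
      integral_mul_left_eq_self (fun s => ((‖a s‖ : ℝ) : ℂ)), mul_right_comm (modC _),
      mul_comm (modC p.fst⁻¹), modC_mul_inv, one_mul]
  have h' := congrArg norm h
  rwa [Complex.norm_real, norm_norm, norm_mul, Complex.norm_real, Real.norm_of_nonneg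
    (by positivity)] at h'

variable {ν} in
/-- The bounded continuous function `(s, t) ↦ ∫∫ b(r) a(q) F(r s, t q) dr dq`. -/
def smoothing (F : Lp ℂ ∞ ν) (b a : C_c(G, ℂ)) : G × Gᵐᵒᵖ →ᵇ ℂ :=
  BoundedContinuousFunction.ofNormedAddCommGroup
    (fun x => (iterConst μ ν)⁻¹ * (ContinuousLinearMap.mul ℂ ℂ).lpPairing ν ∞ 1 F
      (toL1 ν (prodKernel b a (SqGroup.mk x.1 x.2.unop))))
    (continuous_const.mul ((ContinuousLinearMap.continuous _).comp
      ((continuous_toL1_prodKernel μ ν b a).comp (by fun_prop))))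
    (‖F‖ * (‖toL1 μ b‖ * ‖toL1 μ a‖)) fun x => by
      rw [norm_mul, norm_inv]
      have h := norm_lpPairing_mul_le F (toL1 ν (prodKernel b a (SqGroup.mk x.1 x.2.unop)))
      rw [norm_toL1_prodKernel μ, mul_left_comm] at h
      rw [inv_mul_le_iff₀ (norm_pos_iff.2 (iterConst_ne_zero μ ν))]
      exact h

section

variable {ν} (F : Lp ℂ ∞ ν)

theorem smoothing_apply (b a : C_c(G, ℂ)) (x : G × Gᵐᵒᵖ) :
    smoothing μ F b a x = (iterConst μ ν)⁻¹ * (ContinuousLinearMap.mul ℂ ℂ).lpPairing ν ∞ 1 F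
      (toL1 ν (prodKernel b a (SqGroup.mk x.1 x.2.unop))) := rfl

theorem norm_smoothing_le (b a : C_c(G, ℂ)) :
    ‖smoothing μ F b a‖ ≤ ‖F‖ * (‖toL1 μ b‖ * ‖toL1 μ a‖) :=
  BoundedContinuousFunction.norm_ofNormedAddCommGroup_le _ (by positivity) _

theorem dist_smoothing_le (b b' a a' : C_c(G, ℂ)) :
    dist (smoothing μ F b a) (smoothing μ F b' a') ≤
      ‖F‖ * (dist (toL1 μ b) (toL1 μ b') * ‖toL1 μ a‖ +
        ‖toL1 μ b'‖ * dist (toL1 μ a) (toL1 μ a')) := by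
  have h : smoothing μ F b a - smoothing μ F b' a' =
      smoothing μ F (b - b') a + smoothing μ F b' (a - a') := by
    ext x
    simp only [BoundedContinuousFunction.sub_apply, BoundedContinuousFunction.add_apply,
      smoothing_apply, prodKernel_sub_left, prodKernel_sub_right, toL1_sub, map_sub]
    ring
  rw [dist_eq_norm, dist_eq_norm, dist_eq_norm, h, ← toL1_sub, ← toL1_sub, mul_add]
  exact (norm_add_le _ _).trans
    (add_le_add (norm_smoothing_le μ F _ _) (norm_smoothing_le μ F _ _))

theorem smoothing_translate (b a : C_c(G, ℂ)) (h : G × Gᵐᵒᵖ) :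
    (smoothing μ F b a).compContinuous (ContinuousMap.mulLeft h) =
      smoothing μ F (ccRight h.1 b) (ccLeft h.2.unop a) := by
  ext x
  rw [BoundedContinuousFunction.compContinuous_apply, smoothing_apply, smoothing_apply,
    prodKernel_translate]
  rfl

theorem smoothing_mem_LUC (b a : C_c(G, ℂ)) : smoothing μ F b a ∈ LUC (G × Gᵐᵒᵖ) := by
  change Continuous fun h : G × Gᵐᵒᵖ => (smoothing μ F b a).compContinuous (ContinuousMap.mulLeft h)
  simp only [smoothing_translate]
  refine continuous_iff_continuousAt.2 fun h₀ => tendsto_iff_dist_tendsto_zero.2 ?_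
  refine squeeze_zero (fun _ => dist_nonneg) (fun h => dist_smoothing_le μ F _ _ _ _) ?_
  have hb : Continuous fun h : G × Gᵐᵒᵖ => toL1 μ (ccRight h.1 b) :=
    (continuous_toL1_ccRight μ b).comp continuous_fst
  have ha : Continuous fun h : G × Gᵐᵒᵖ => toL1 μ (ccLeft h.2.unop a) :=
    (continuous_toL1_ccLeft μ a).comp (continuous_unop.comp continuous_snd)
  have hc : Continuous fun h : G × Gᵐᵒᵖ =>
      ‖F‖ * (dist (toL1 μ (ccRight h.1 b)) (toL1 μ (ccRight h₀.1 b)) *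
        ‖toL1 μ (ccLeft h.2.unop a)‖ + ‖toL1 μ (ccRight h₀.1 b)‖ *
          dist (toL1 μ (ccLeft h.2.unop a)) (toL1 μ (ccLeft h₀.2.unop a))) := by
    fun_prop
  simpa using hc.tendsto h₀

end

/-- `bcfToLInfty` as a continuous linear map. -/
def bcfToLInftyL (ν : Measure (SqGroup G)) : (G × Gᵐᵒᵖ →ᵇ ℂ) →L[ℂ] Lp ℂ ∞ ν :=
  (bcfToLInfty ν).mkContinuous 1 fun f => by
    rw [one_mul]
    refine (Lp.norm_toLp _ (memLp_top_comp_toProdOp ν f)).trans_le (ENNReal.toReal_le_of_le_ofReal (norm_nonneg _) ?_)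
    rw [eLpNorm_exponent_top]
    exact eLpNormEssSup_le_of_ae_bound
      (Eventually.of_forall fun p => f.norm_coe_le_norm p.toProdOp)

variable {ν}

theorem dualPairing_eq (F : Lp ℂ ∞ ν) (w : Lp ℂ 1 ν) :
    dualPairing ν F w = (ContinuousLinearMap.mul ℂ ℂ).lpPairing ν ∞ 1 F w :=
  (lpPairing_mul_apply F w).symm

theorem dualPairing_bcf (f : G × Gᵐᵒᵖ →ᵇ ℂ) (w : Lp ℂ 1 ν) :
    dualPairing ν (bcfToLInfty ν f) w = ∫ p, f p.toProdOp * w p ∂ν := by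
  refine integral_congr_ae ?_
  filter_upwards [(memLp_top_comp_toProdOp ν f).coeFn_toLp] with p hp
  exact congrArg (· * w p) hp

theorem continuous_dualPairing (F : Lp ℂ ∞ ν) : Continuous (dualPairing ν F) := by
  have h : dualPairing ν F = (ContinuousLinearMap.mul ℂ ℂ).lpPairing ν ∞ 1 F :=
    funext fun w => dualPairing_eq F w
  rw [h]
  exact ContinuousLinearMap.continuous _

/-- For w in `C_c`, integrating w(p) times the kernel at p gives b·w·a up to `iterConst`. This is a
Bochner integral in L¹, so pairing with F passes through it; density of `C_c` gives all w. -/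
theorem isDualAct_smoothing (F : Lp ℂ ∞ ν) (b a : C_c(G, ℂ)) :
    IsDualAct μ ν (toL1 μ a) F (toL1 μ b) (bcfToLInfty ν (smoothing μ F b a)) := by
  intro w
  have hcont : Continuous fun w => dualPairing ν F
      (rightAct μ ν (leftAct μ ν (toL1 μ b) w) (toL1 μ a)) :=
    (continuous_dualPairing F).comp
      ((rightActL μ ν (toL1 μ a)).continuous.comp (leftActL μ ν (toL1 μ b)).continuous)
  refine congrFun (DenseRange.equalizer (denseRange_toL1 ν)
    (continuous_dualPairing _) hcont (funext fun w => ?_)) w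
  simp only [Function.comp_apply]
  obtain ⟨g, hg1, hg2⟩ := rightAct_leftAct_toL1 μ ν a b w
  have hm := continuous_modC μ
  have hN : IsCompact (tsupport w) := w.hasCompactSupport
  have hsupp : ∀ p ∉ tsupport w, ∀ z, (w p • prodKernel b a p) z = 0 := fun p hp z => by
    rw [CompactlySupportedContinuousMap.smul_apply, image_eq_zero_of_notMem_tsupport hp, zero_smul]
  obtain ⟨g', hg'1, hg'2, hint⟩ := integral_toL1_eq ν ν (κ := fun p => w p • prodKernel b a p)
    (by
      simp only [CompactlySupportedContinuousMap.smul_apply, prodKernel_apply]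
      fun_prop)
    (isCompact_prodKernel_support b a hN) hN (fun p z hz => by
      by_cases hp : p ∈ tsupport w
      · rw [CompactlySupportedContinuousMap.smul_apply, prodKernel_apply,
          prodKernel_support b a hp hz, smul_zero]
      · exact hsupp p hp z) hsupp
  have hgg' : g' = iterConst μ ν • g := by
    ext z
    rw [hg'1, CompactlySupportedContinuousMap.smul_apply, hg1, smul_eq_mul,
      integral_eq_iterated μ ν (f := fun p => (w p • prodKernel b a p) z)]
    · rfl
    · simp only [CompactlySupportedContinuousMap.smul_apply, prodKernel_apply]
      fun_prop
    · exact HasCompactSupport.intro hN fun p hp => hsupp p hp z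
  have h1 : dualPairing ν (bcfToLInfty ν (smoothing μ F b a)) (toL1 ν w) =
      ∫ p, (iterConst μ ν)⁻¹ * (ContinuousLinearMap.mul ℂ ℂ).lpPairing ν ∞ 1 F
        (toL1 ν (w p • prodKernel b a p)) ∂ν := by
    rw [dualPairing_bcf]
    refine integral_congr_ae ?_
    filter_upwards [coeFn_toL1 ν w] with p hp
    rw [hp, smoothing_apply, toL1_smul, map_smul, smul_eq_mul, mul_right_comm, mul_assoc _ (w p)]
    congr 1
  rw [h1, integral_const_mul, ContinuousLinearMap.integral_comp_comm _ hint, hg'2, hgg', toL1_smul,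
    map_smul, smul_eq_mul, inv_mul_cancel_left₀ (iterConst_ne_zero μ ν), hg2, dualPairing_eq]

/-- Two essentially bounded functions with the same pairings agree. -/
theorem eq_of_dualPairing_eq {Φ Ψ : Lp ℂ ∞ ν}
    (h : ∀ w : Lp ℂ 1 ν, dualPairing ν Φ w = dualPairing ν Ψ w) : Φ = Ψ := by
  rw [← sub_eq_zero]
  set D := Φ - Ψ with hD
  have h0 : ∀ w : Lp ℂ 1 ν, ∫ p, D p * w p ∂ν = 0 := fun w => by
    have h1 := h w
    rw [dualPairing_eq, dualPairing_eq, ← sub_eq_zero] at h1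
    rw [← lpPairing_mul_apply, hD, map_sub, _root_.sub_apply]
    exact h1
  have hmeas : MeasurableSet {p | D p ≠ 0} :=
    (Lp.stronglyMeasurable D).measurable (measurableSet_singleton (0 : ℂ)).compl
  have hnull : ν {p | D p ≠ 0} = 0 := by
    by_contra hne
    -- The conjugate of D need not be integrable, so it is cut off to a compact K of positive
    -- measure on which D never vanishes; pairing with D then gives ∫ |D|² over K.
    obtain ⟨K, hKD, hK, hKpos⟩ := hmeas.exists_lt_isCompact (pos_iff_ne_zero.2 hne)
    have hbound : MemLp (K.indicator fun p => star (D p)) 1 ν := by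
      have h1 : MemLp (fun p => star (D p)) ∞ (ν.restrict K) := ((Lp.memLp D).star).restrict K
      have : IsFiniteMeasure (ν.restrict K) := ⟨by simpa using hK.measure_lt_top⟩
      exact (memLp_indicator_iff_restrict hK.measurableSet).2 (h1.mono_exponent le_top)
    have h1 := h0 (hbound.toLp _)
    have h2 : ∫ p in K, ((‖D p‖ ^ 2 : ℝ) : ℂ) ∂ν = 0 := by
      rw [← h1, ← integral_indicator hK.measurableSet]
      refine integral_congr_ae ?_
      filter_upwards [hbound.coeFn_toLp] with p hp
      rw [hp]
      by_cases hpK : p ∈ K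
      · simp only [hpK, Set.indicator_of_mem]
        rw [← Complex.normSq_eq_norm_sq, ← Complex.mul_conj]
        rfl
      · simp [hpK]
    rw [integral_complex_ofReal, Complex.ofReal_eq_zero] at h2
    have hint : IntegrableOn (fun p => ‖D p‖ ^ 2) K ν := by
      have h1 : MemLp D ∞ (ν.restrict K) := (Lp.memLp D).restrict K
      have : IsFiniteMeasure (ν.restrict K) := ⟨by simpa using hK.measure_lt_top⟩
      exact (h1.mono_exponent (p := 2) le_top).integrable_norm_pow (by norm_num)
    rw [setIntegral_eq_zero_iff_of_nonneg_ae
      (Eventually.of_forall fun p => by positivity) hint] at h2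
    have h3 : ν K = 0 := by
      have h4 : ∀ᵐ p ∂ν, p ∉ K := by
        filter_upwards [(ae_restrict_iff' hK.measurableSet).1 h2] with p hp hpK
        exact hKD hpK (by simpa using hp hpK)
      simpa [ae_iff] using h4
    exact hKpos.ne' h3
  exact Lp.eq_zero_iff_ae_eq_zero.2 (by simpa [Filter.EventuallyEq, ae_iff] using hnull)

/-- Translations do not increase the sup norm, so uniform approximation of f gives uniform
approximation of its orbit map. -/
theorem isClosed_LUC {H : Type*} [TopologicalSpace H] [Group H] [IsTopologicalGroup H] :
    IsClosed (LUC H : Set (H →ᵇ ℂ)) := by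
  refine isClosed_of_closure_subset fun f hf => ?_
  change Continuous fun x : H => f.compContinuous (ContinuousMap.mulLeft x)
  refine continuous_of_uniform_approx_of_continuous fun u hu => ?_
  obtain ⟨ε, hε, hεu⟩ := Metric.mem_uniformity_dist.1 hu
  obtain ⟨g, hg, hfg⟩ := Metric.mem_closure_iff.1 hf ε hε
  refine ⟨_, hg, fun x => hεu (lt_of_le_of_lt ?_ hfg)⟩
  exact (BoundedContinuousFunction.dist_le dist_nonneg).2 fun t =>
    BoundedContinuousFunction.dist_coe_le_dist (f := f) (g := g) (x * t)

/-- Every product `a · F · b` is represented by a left uniformly continuous function. -/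
theorem exists_LUC_isDualAct (a : Lp ℂ 1 μ) (F : Lp ℂ ∞ ν) (b : Lp ℂ 1 μ) :
    ∃ f ∈ LUC (G × Gᵐᵒᵖ), IsDualAct μ ν a F b (bcfToLInfty ν f) := by
  obtain ⟨u, hu, hua⟩ := mem_closure_iff_seq_limit.1 (denseRange_toL1 μ a)
  obtain ⟨v, hv, hvb⟩ := mem_closure_iff_seq_limit.1 (denseRange_toL1 μ b)
  choose α hα using hu
  choose β hβ using hv
  set f : ℕ → G × Gᵐᵒᵖ →ᵇ ℂ := fun n => smoothing μ F (β n) (α n) with hf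
  -- The smoothings for approximating sequences in `C_c` are Cauchy in sup norm, by bilinearity and
  -- the bound in L¹ norms; their uniform limit stays in LUC.
  have hcauchy : CauchySeq f := by
    rw [cauchySeq_iff_tendsto_dist_atTop_0]
    refine squeeze_zero (fun _ => dist_nonneg) (fun n => dist_smoothing_le μ F _ _ _ _) ?_
    simp only [hα, hβ]
    rw [← prod_atTop_atTop_eq]
    have ha₁ := hua.comp (tendsto_fst (f := atTop (α := ℕ)) (g := atTop (α := ℕ)))
    have ha₂ := hua.comp (tendsto_snd (f := atTop (α := ℕ)) (g := atTop (α := ℕ)))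
    have hb₁ := hvb.comp (tendsto_fst (f := atTop (α := ℕ)) (g := atTop (α := ℕ)))
    have hb₂ := hvb.comp (tendsto_snd (f := atTop (α := ℕ)) (g := atTop (α := ℕ)))
    simpa using (((hb₁.dist hb₂).mul ha₁.norm).add (hb₂.norm.mul (ha₁.dist ha₂))).const_mul ‖F‖
  obtain ⟨f₀, hf₀⟩ := cauchySeq_tendsto_of_complete hcauchy
  refine ⟨f₀, ?_, fun w => ?_⟩
  · exact isClosed_LUC.mem_of_tendsto hf₀
      (Eventually.of_forall fun n => smoothing_mem_LUC μ F (β n) (α n))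
  · have h1 : Tendsto (fun n => dualPairing ν (bcfToLInfty ν (f n)) w) atTop
        (𝓝 (dualPairing ν (bcfToLInfty ν f₀) w)) := by
      simp only [dualPairing_eq]
      exact ((((ContinuousLinearMap.mul ℂ ℂ).lpPairing ν ∞ 1).flip w ∘L
        bcfToLInftyL ν).continuous.tendsto f₀).comp hf₀
    have h2 : Tendsto (fun n => dualPairing ν (bcfToLInfty ν (f n)) w) atTop
        (𝓝 (dualPairing ν F (rightAct μ ν (leftAct μ ν b w) a))) := by
      have h3 : ∀ n, dualPairing ν (bcfToLInfty ν (f n)) w =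
          dualPairing ν F (rightActL μ ν (u n) (leftActL μ ν (v n) w)) := fun n => by
        rw [hf, isDualAct_smoothing μ F (β n) (α n) w, hα, hβ]
        rfl
      simp only [h3]
      refine ((continuous_dualPairing F).tendsto _).comp ?_
      exact tendsto_clm_apply (((rightActL μ ν).continuous.tendsto a).comp hua)
        (tendsto_clm_apply (((leftActL μ ν).continuous.tendsto b).comp hvb) tendsto_const_nhds)
    exact tendsto_nhds_unique h1 h2

end Smoothing

/-! ### Translations on the Banach space LUC(H). -/

section LUCTranslate

variable {H : Type*} [TopologicalSpace H] [Group H] [IsTopologicalGroup H]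

instance : CompleteSpace (LUC H) := isClosed_LUC.completeSpace_coe

/-- Left translation `f ↦ (t ↦ f (x t))` on `LUC(H)`. -/
def lucTranslate (x : H) : LUC H →L[ℂ] LUC H :=
  LinearMap.mkContinuous
    { toFun := fun f => ⟨f.1.compContinuous (ContinuousMap.mulLeft x), by
        change Continuous fun y : H => (f.1.compContinuous
          (ContinuousMap.mulLeft x)).compContinuous (ContinuousMap.mulLeft y)
        have h : Continuous fun y : H => f.1.compContinuous (ContinuousMap.mulLeft (x * y)) :=
          (show Continuous fun y : H => f.1.compContinuous (ContinuousMap.mulLeft y) from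
            f.2).comp (continuous_const_mul x)
        convert! h using 2 with y
        ext t
        exact congrArg f.1 (mul_assoc x y t).symm⟩
      map_add' := fun _ _ => rfl
      map_smul' := fun _ _ => rfl } 1 fun f => by
    rw [one_mul]
    exact (BoundedContinuousFunction.norm_le (norm_nonneg _)).2 fun t =>
      f.1.norm_coe_le_norm (x * t)

theorem lucTranslate_apply (x : H) (f : LUC H) (t : H) :
    (lucTranslate x f : H →ᵇ ℂ) t = (f : H →ᵇ ℂ) (x * t) := rfl

theorem norm_lucTranslate_le (x : H) : ‖lucTranslate x‖ ≤ 1 :=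
  LinearMap.mkContinuous_norm_le _ zero_le_one _

theorem continuous_lucTranslate (f : LUC H) : Continuous fun x => lucTranslate x f :=
  Continuous.subtype_mk f.2 _

theorem lucTranslate_lucTranslate (x y : H) (f : LUC H) :
    lucTranslate x (lucTranslate y f) = lucTranslate (y * x) f := by
  ext t
  simp only [lucTranslate_apply, mul_assoc]

theorem lucTranslate_one : lucTranslate (1 : H) = 1 := by
  ext f t
  simp only [lucTranslate_apply, one_mul]
  rfl

end LUCTranslate

/-! ### Factoring left uniformly continuous functions. -/

section Factor

variable {G : Type*} [Group G] [TopologicalSpace G] [IsTopologicalGroup G] [LocallyCompactSpace G]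
  [T2Space G] [MeasurableSpace G] [BorelSpace G]
  (μ : Measure G) [μ.IsHaarMeasure] [μ.InnerRegular]

/-- The action `f ↦ ((s, t) ↦ ∫ b(r) f(r s, t) dr)` of `L¹(G)` on `LUC(G × Gᵒᵖ)`. -/
def lucLeft : Lp ℂ 1 μ →L[ℂ] LUC (G × Gᵐᵒᵖ) →L[ℂ] LUC (G × Gᵐᵒᵖ) :=
  integrated μ (fun r => lucTranslate (r, 1))
    (fun f => (continuous_lucTranslate f).comp (by fun_prop)) fun _ => norm_lucTranslate_le _

/-- The action `f ↦ ((s, t) ↦ ∫ a(q) f(s, t q) dq)` of `L¹(G)` on `LUC(G × Gᵒᵖ)`. -/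
def lucRight : Lp ℂ 1 μ →L[ℂ] LUC (G × Gᵐᵒᵖ) →L[ℂ] LUC (G × Gᵐᵒᵖ) :=
  integrated μ (fun q => lucTranslate (1, op q))
    (fun f => (continuous_lucTranslate f).comp (by fun_prop)) fun _ => norm_lucTranslate_le _

/-- Translations compose in reverse order, so translating by r after averaging against a is
averaging against a right translate of a. This is L¹-continuous in r, which is the regularity
Cohen's theorem asks for. -/
theorem exists_lucLeft_eq (f : LUC (G × Gᵐᵒᵖ)) : ∃ b g, lucLeft μ b g = f := by
  refine exists_integrated_eq μ (V := fun r => lucTranslate (r, (1 : Gᵐᵒᵖ))) _ _ lucTranslate_one (fun a => ?_) f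
  have h : ∀ r : G, lucTranslate (r, 1) * lucLeft μ (toL1 μ a) = lucLeft μ (toL1 μ (ccRight r a)) := by
    intro r
    refine ContinuousLinearMap.ext fun f => ?_
    rw [mul_apply_eq_comp, lucLeft, integrated_apply, integrated_toL1_apply,
      ← ContinuousLinearMap.integral_comp_comm _ (integrable_integrated μ
        (fun f => (continuous_lucTranslate f).comp (by fun_prop))
        (fun _ => norm_lucTranslate_le _) _ _)]
    have h1 := integral_mul_right_modC_smul μ
      (fun u => a (u * r⁻¹) • lucTranslate (u, (1 : Gᵐᵒᵖ)) f) r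
    simp only [mul_inv_cancel_right] at h1
    simp only [ccRight_apply, mul_smul]
    rw [integral_smul, ← h1]
    refine integral_congr_ae ?_
    filter_upwards [coeFn_toL1 μ a] with u hu
    rw [hu, map_smul, lucTranslate_lucTranslate, Prod.mk_mul_mk, one_mul]
  change Tendsto (fun r => lucTranslate (r, 1) * lucLeft μ (toL1 μ a)) _ (𝓝 (lucLeft μ (toL1 μ a)))
  simp only [h]
  have hc := ((lucLeft μ).continuous.comp (continuous_toL1_ccRight μ a)).tendsto 1
  rwa [Function.comp_apply, ccRight_one] at hc

/-- In the opposite group the reversal is undone: a is translated on the left, with no modular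
factor. -/
theorem exists_lucRight_eq (f : LUC (G × Gᵐᵒᵖ)) : ∃ a g, lucRight μ a g = f := by
  refine exists_integrated_eq μ (V := fun q => lucTranslate ((1 : G), op q)) _ _ lucTranslate_one (fun a => ?_) f
  have h : ∀ r : G, lucTranslate (1, op r) * lucRight μ (toL1 μ a) =
      lucRight μ (toL1 μ (ccLeft r a)) := by
    intro r
    refine ContinuousLinearMap.ext fun f => ?_
    rw [mul_apply_eq_comp, lucRight, integrated_apply, integrated_toL1_apply,
      ← ContinuousLinearMap.integral_comp_comm _ (integrable_integrated μ
        (fun f => (continuous_lucTranslate f).comp (by fun_prop))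
        (fun _ => norm_lucTranslate_le _) _ _),
      ← integral_mul_left_eq_self (fun u => ccLeft r a u • _) r]
    refine integral_congr_ae ?_
    filter_upwards [coeFn_toL1 μ a] with u hu
    rw [hu, map_smul, lucTranslate_lucTranslate, Prod.mk_mul_mk, one_mul, ← op_mul, ccLeft_apply,
      inv_mul_cancel_left]
  change Tendsto (fun r => lucTranslate (1, op r) * lucRight μ (toL1 μ a)) _
    (𝓝 (lucRight μ (toL1 μ a)))
  simp only [h]
  have hc := ((lucRight μ).continuous.comp (continuous_toL1_ccLeft μ a)).tendsto 1
  rwa [Function.comp_apply, ccLeft_one] at hc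

variable (ν : Measure (SqGroup G)) [ν.IsHaarMeasure] [ν.InnerRegular]

/-- Integration against `w ∈ L¹(G × G)` as a functional on `LUC(G × Gᵒᵖ)`. -/
def lucPairing {ν : Measure (SqGroup G)} (w : Lp ℂ 1 ν) : LUC (G × Gᵐᵒᵖ) →L[ℂ] ℂ :=
  ((ContinuousLinearMap.mul ℂ ℂ).lpPairing ν ∞ 1).flip w ∘L bcfToLInftyL ν ∘L
    (LUC (G × Gᵐᵒᵖ)).subtypeL

theorem lucPairing_apply {ν : Measure (SqGroup G)} (w : Lp ℂ 1 ν) (f : LUC (G × Gᵐᵒᵖ)) :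
    lucPairing w f = dualPairing ν (bcfToLInfty ν f) w :=
  lpPairing_mul_apply (bcfToLInfty ν f) w

/-- This adjointness for point masses integrates to the adjointness of `lucLeft` and `leftAct`. -/
theorem lucPairing_translate_left (w : Lp ℂ 1 ν) (f : LUC (G × Gᵐᵒᵖ)) (r : G) :
    lucPairing w (lucTranslate (r, 1) f) = lucPairing (leftTranslate ν r w) f := by
  rw [lucPairing_apply, lucPairing_apply, dualPairing_bcf, dualPairing_bcf,
    ← integral_mul_left_eq_self (fun p => f.1 p.toProdOp * leftTranslate ν r w p)
      (SqGroup.mk r 1)]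
  have h1 := Lp.coeFn_compMeasurePreserving w (measurePreserving_mul_left ν (SqGroup.mk r⁻¹ 1))
  refine integral_congr_ae ?_
  filter_upwards [(measurePreserving_mul_left ν (SqGroup.mk r 1)).quasiMeasurePreserving.ae h1]
    with p hp
  have h2 : SqGroup.mk r⁻¹ 1 * (SqGroup.mk r 1 * p) = p := by
    rw [← mul_assoc, SqGroup.mk_mul_mk, inv_mul_cancel, one_mul, SqGroup.mk_one_one, one_mul]
  rw [leftTranslate, hp, Function.comp_apply, h2, lucTranslate_apply, SqGroup.toProdOp_eq,
    SqGroup.toProdOp_eq]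
  simp

theorem lucPairing_translate_right (μ : Measure G) [μ.IsHaarMeasure] [μ.InnerRegular]
    (ν : Measure (SqGroup G)) [ν.IsHaarMeasure] [ν.InnerRegular] (w : Lp ℂ 1 ν)
    (f : LUC (G × Gᵐᵒᵖ)) (q : G) :
    lucPairing w (lucTranslate (1, op q) f) = lucPairing (rightTranslate ν q w) f := by
  rw [lucPairing_apply, lucPairing_apply, dualPairing_bcf, dualPairing_bcf]
  have h1 := integral_mul_right_modC ν
    (fun p => f.1 p.toProdOp * w (p * SqGroup.mk 1 q⁻¹)) (SqGroup.mk 1 q)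
  rw [modC_mk_one μ ν, ← integral_const_mul] at h1
  have h2 : ∀ p : SqGroup G, p * SqGroup.mk 1 q * SqGroup.mk 1 q⁻¹ = p := fun p => by
    rw [mul_assoc, SqGroup.mk_mul_mk, mul_inv_cancel, one_mul, SqGroup.mk_one_one, mul_one]
  simp only [h2] at h1
  refine Eq.trans ?_ (h1.trans (integral_congr_ae ?_))
  · refine integral_congr_ae (Eventually.of_forall fun p => ?_)
    simp [lucTranslate_apply, SqGroup.toProdOp_eq]
  · filter_upwards [coeFn_rightTranslate ν q w] with p hp
    rw [hp, mul_left_comm]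

theorem lucPairing_lucLeft (w : Lp ℂ 1 ν) (b : Lp ℂ 1 μ) (f : LUC (G × Gᵐᵒᵖ)) :
    lucPairing w (lucLeft μ b f) = lucPairing (leftAct μ ν b w) f := by
  rw [lucLeft, clm_integrated, lucPairing_apply, dualPairing_eq, ← leftActL_apply, leftActL,
    clm_integrated]
  simp only [lucPairing_translate_left]
  simp only [lucPairing_apply, dualPairing_eq, leftTranslateL_apply]

theorem lucPairing_lucRight (w : Lp ℂ 1 ν) (a : Lp ℂ 1 μ) (f : LUC (G × Gᵐᵒᵖ)) :
    lucPairing w (lucRight μ a f) = lucPairing (rightAct μ ν w a) f := by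
  rw [lucRight, clm_integrated, lucPairing_apply, dualPairing_eq, ← rightActL_apply, rightActL,
    clm_integrated]
  simp only [lucPairing_translate_right μ]
  simp only [lucPairing_apply, dualPairing_eq, rightTranslateL_apply]

/-- Every left uniformly continuous function is a product `a · F · b`. -/
theorem exists_isDualAct_of_mem_LUC {f : G × Gᵐᵒᵖ →ᵇ ℂ} (hf : f ∈ LUC (G × Gᵐᵒᵖ)) :
    ∃ (a : Lp ℂ 1 μ) (F : Lp ℂ ∞ ν) (b : Lp ℂ 1 μ), IsDualAct μ ν a F b (bcfToLInfty ν f) := by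
  -- The first factorization stays inside LUC, so g can be factored again in the other coordinate.
  obtain ⟨b, g, hg⟩ := exists_lucLeft_eq μ ⟨f, hf⟩
  obtain ⟨a, F, hF⟩ := exists_lucRight_eq μ g
  refine ⟨a, bcfToLInfty ν F, b, fun w => ?_⟩
  have h : lucPairing w ⟨f, hf⟩ = lucPairing (rightAct μ ν (leftAct μ ν b w) a) F := by
    rw [← hg, ← hF, lucPairing_lucLeft, lucPairing_lucRight]
  rwa [lucPairing_apply, lucPairing_apply] at h

end Factor

end

/-! ### The main theorem. -/

theorem theoremt {G : Type*} [Group G] [TopologicalSpace G] [IsTopologicalGroup G]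
    [LocallyCompactSpace G] [T2Space G] [MeasurableSpace G] [BorelSpace G]
    (μ : Measure G) [μ.IsHaarMeasure] [μ.InnerRegular]
    (ν : Measure (SqGroup G)) [ν.IsHaarMeasure] [ν.InnerRegular] :
    (∀ (a : Lp ℂ 1 μ) (F : Lp ℂ ∞ ν) (b : Lp ℂ 1 μ), ∃! Φ : Lp ℂ ∞ ν, IsDualAct μ ν a F b Φ) ∧
      essentialPart μ ν = (LUC (G × Gᵐᵒᵖ)).map (bcfToLInfty ν) := by
  -- Uniqueness shows that the LUC representative of a·F·b is the product itself, as needed for the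
  -- first inclusion.
  have huniq : ∀ {a : Lp ℂ 1 μ} {F : Lp ℂ ∞ ν} {b : Lp ℂ 1 μ} {Φ Ψ : Lp ℂ ∞ ν},
      IsDualAct μ ν a F b Φ → IsDualAct μ ν a F b Ψ → Φ = Ψ := fun h h' =>
    eq_of_dualPairing_eq fun w => (h w).trans (h' w).symm
  refine ⟨fun a F b => ?_, le_antisymm (Submodule.span_le.2 ?_) ?_⟩
  · obtain ⟨f, -, hf⟩ := exists_LUC_isDualAct μ a F b
    exact ⟨_, hf, fun Ψ hΨ => huniq hΨ hf⟩
  · rintro Φ ⟨a, F, b, hΦ⟩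
    obtain ⟨f, hfL, hf⟩ := exists_LUC_isDualAct μ a F b
    exact ⟨f, hfL, huniq hf hΦ⟩
  · rintro _ ⟨f, hf, rfl⟩
    exact Submodule.subset_span (exists_isDualAct_of_mem_LUC μ ν hf)
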